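/- For $M,N\ge 1$ let $G$ be an $M\times N$ matrix with i.i.d. standard Gaussian entries and rows $g_1,\dots,g_M$, and for $\kappa>0$ let $$S(G;\kappa)=\Big\{\sigma\in\{-1,1\}^N:\ \tfrac{1}{\sqrt N}\langle g_i,\sigma\rangle\in[-\kappa,\kappa]\ \text{ for all } 1\le i\le M\Big\}$$ be the solution set of the symmetric binary perceptron. A (randomized) degree-$D$ polynomial algorithm is a measurable map $A^\circ:(G,\omega)\mapsto A^\circ(G,\omega)\in\mathbb R^N$, where $\omega$ is a random variable in some Polish space $\Omega$, independent of $G$, such that for every fixed $\omega$ each of the $N$ output coordinates is a polynomial of degree at most $D$ in the entries of $G$. Its randomized rounding is $A(G,\omega,U)\in\{-1,1\}^N$, with $A(G,\omega,U)_j=1$ if $A^\circ(G,\omega)_j\ge U_j$ and $A(G,\omega,U)_j=-1$ otherwise, where $U_1,\dots,U_N$ are i.i.d. uniform on $[-1,1]$ and $U=(U_1,\dots,U_N)$ is independent of $(G,\omega)$. **Corollary.** There exists $\kappa_0>0$ such that the following holds for every $\kappa\in(0,\kappa_0)$ and every real $\alpha\ge 10\kappa^2\log(1/\kappa)$. Let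 $(M_N)$ be positive integers with $M_N/N\to\alpha$, let $(D_N)$ be nonnegative integers with $D_N=o(N/\log N)$ as $N\to\infty$, and let $C>0$. Then there is a sequence $p_N\to 0$, depending only on $\kappa,\alpha,(M_N),(D_N),C$, such that for every $N$, every degree-$D_N$ polynomial algorithm $A^\circ$ on $M_N\times N$ matrices with $\mathbb E\big[\|A^\circ(G,\omega)\|^2\big]\le CN$ satisfies $$\mathbb P\big[A(G,\omega,U)\in S(G;\kappa)\big]\le p_N .$$ In other words, the probability that $A$ solves the symmetric binary perceptron is $o_N(1)$. -/

import Mathlib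

open MeasureTheory ProbabilityTheory Filter Topology Asymptotics

namespace IsingPerceptron

/-- The disorder: an `M × N` real matrix `G`, identified with the vector of its `M * N` entries;
its rows are `g_1, …, g_M ∈ ℝ^N`. -/
abbrev Disorder (M N : ℕ) : Type := Fin M × Fin N → ℝ

/-- The law of the disorder: all entries i.i.d. standard Gaussian. -/
noncomputable def disorderLaw (M N : ℕ) : Measure (Disorder M N) :=
  Measure.pi fun _ => gaussianReal 0 1

/-- The law of `(U_1, …, U_N)` with `U_i` i.i.d. uniform on `[-1, 1]`. -/
noncomputable def roundingLaw (N : ℕ) : Measure (Fin N → ℝ) :=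
  Measure.pi fun _ => (volume : Measure ℝ)[|Set.Icc (-1 : ℝ) 1]

/-- The cube `Σ_N = {-1, 1}^N`. -/
def cube (N : ℕ) : Set (Fin N → ℝ) := {σ | ∀ j, σ j = 1 ∨ σ j = -1}

/-- The solution set `S(G; I)`: the points `σ` of the cube such that `⟨g_i, σ⟩ / √N ∈ I` for
every row `g_i` of `G`. -/
def solutions {M N : ℕ} (G : Disorder M N) (I : Set ℝ) : Set (Fin N → ℝ) :=
  {σ | σ ∈ cube N ∧ ∀ i : Fin M, (∑ j, G (i, j) * σ j) / √(N : ℝ) ∈ I}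

/-- Coordinatewise randomized rounding: coordinate `j` is `1` if `x j ≥ U j` and `-1` otherwise. -/
noncomputable def round {N : ℕ} (U : Fin N → ℝ) (x : EuclideanSpace ℝ (Fin N)) : Fin N → ℝ :=
  fun j => if U j ≤ x j then 1 else -1

/-- `A` is a degree `D` polynomial: for every fixed value `ω` of the auxiliary randomness, each
output coordinate is a polynomial of degree at most `D` in the entries of the disorder. -/
def IsPolynomialOfDegree {M N : ℕ} {Ω : Type*} (D : ℕ)
    (A : Disorder M N → Ω → EuclideanSpace ℝ (Fin N)) : Prop :=
  ∀ (ω : Ω) (j : Fin N), ∃ P : MvPolynomial (Fin M × Fin N) ℝ,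
    P.totalDegree ≤ D ∧ ∀ G, A G ω j = MvPolynomial.eval G P

/-- `E ‖A(G, ω)‖²`, for `G` Gaussian and `ω` independent of `G` with law `μ`. -/
noncomputable def secondMoment {M N : ℕ} {Ω : Type*} [MeasurableSpace Ω] (μ : Measure Ω)
    (A : Disorder M N → Ω → EuclideanSpace ℝ (Fin N)) : ENNReal :=
  ∫⁻ z, ENNReal.ofReal (‖A z.1 z.2‖ ^ 2) ∂((disorderLaw M N).prod μ)

/-- The probability that the randomized rounding of `A(G, ω)` lies in `S(G; I)`, where the Gaussian
disorder `G`, the auxiliary randomness `ω` (of law `μ`) and the thresholds `U` are independent. -/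
noncomputable def successProbability {M N : ℕ} {Ω : Type*} [MeasurableSpace Ω] (μ : Measure Ω)
    (A : Disorder M N → Ω → EuclideanSpace ℝ (Fin N)) (I : Set ℝ) : ℝ :=
  (((disorderLaw M N).prod μ).prod (roundingLaw N)).real
    {z | round z.2 (A z.1.1 z.1.2) ∈ solutions z.1.1 I}

end IsingPerceptron

/-! The proof plays many correlated instances against each other. Run the chain `X ↦ a X + b Z` with
`a ^ 2 + b ^ 2 = 1` and `a = 1 - c / (D + 1)`, and suppose that an algorithm succeeds with
probability at least `δ`.

Lower bound. A polynomial of degree `D` moves little in `L²` over one step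
(`integral_sq_step_sub_le`), and so does its rounding with shared thresholds. Two consecutive states
are both solved with probability at least the square of the success probability
(`sq_measure_le_lintegral_transfer`). Hence, for a suitable fixed seed, one transition is stable
(both ends solved, outputs close) with probability at least `δ ^ 2 / 2`. The chain is reversible and
stability is symmetric, so repeated Cauchy–Schwarz (`pow_le_lintegral_transfer_iterate`) makes all
`2 ^ r` transitions stable with probability at least `(δ ^ 2 / 2) ^ 2 ^ r`. With `2 ^ r` of order `D
+ 1` this is `exp (-O(D + 1))`.

Upper bound. On that event the outputs form a slow path in the cube, each point solving its own
instance. From the path one extracts `n + 1` points, each within `t √N` of the span of its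
predecessors, and either at distance at least `s √N` from that span or visited at least `L` steps
after all of them (`exists_admissible`). In the first case the new point supplies a fresh spatial
direction, in the second the disorder supplies fresh noise. Either way each of the `M` constraints
costs a further factor `2κ / (√(2π) s)` (`smallBall_admissible`). Nearness keeps the entropy low:
each point after the first contributes only about `exp (N * ballRate (2 κ ^ 2))` choices
(`card_nearTuples_le`).

With `s = 4κ/3` the factor is at most `exp (-1/2)`. A new point then costs at least `(9/2) κ² log
(1/κ) N` in the exponent against an entropy of at most `(4 κ² log (1/κ) + 2 κ²) N`. A constant
number `n ≥ 2 / κ²` of points also pays for the `2 ^ N` choices of the first one. The first moment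
is therefore exponentially small in `N`, up to a factor `exp (O(D + 1))`, which contradicts the
lower bound once `N ≥ B (D + 1)` for a large constant `B`. -/

namespace IsingPerceptron

/-! ### Gaussian rotations and small-ball estimates. -/

/-- The standard Gaussian measure on `ι → ℝ`. -/
noncomputable def gaussianPi (ι : Type*) [Fintype ι] : Measure (ι → ℝ) :=
  Measure.pi fun _ => gaussianReal 0 1

instance (ι : Type*) [Fintype ι] : IsProbabilityMeasure (gaussianPi ι) := by
  unfold gaussianPi; infer_instance

lemma charFunDual_gaussianReal_standard (L : StrongDual ℝ ℝ) :
    charFunDual (gaussianReal 0 1) L = Complex.exp (-(L 1 : ℂ) ^ 2 / 2) := by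
  rw [charFunDual_eq_charFun_map_one, gaussianReal_map_continuousLinearMap, charFun_gaussianReal]
  congr 1
  simp [Real.coe_toNNReal _ (sq_nonneg (L 1)), neg_div]

/-- The matrix is orthogonal and symmetric, hence an involution. Applying it exchanges the two
members of the pair `(X, a X + b Z)`; this is the source of reversibility of the chain. -/
lemma measurePreserving_rotate_gaussianReal {a b : ℝ} (h : a ^ 2 + b ^ 2 = 1) :
    MeasurePreserving (fun p : ℝ × ℝ => (a * p.1 + b * p.2, b * p.1 - a * p.2))
      ((gaussianReal 0 1).prod (gaussianReal 0 1)) ((gaussianReal 0 1).prod (gaussianReal 0 1)) := by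
  refine ⟨by fun_prop, ?_⟩
  let T : ℝ × ℝ →L[ℝ] ℝ × ℝ :=
    (a • ContinuousLinearMap.fst ℝ ℝ ℝ + b • ContinuousLinearMap.snd ℝ ℝ ℝ).prod
      (b • ContinuousLinearMap.fst ℝ ℝ ℝ - a • ContinuousLinearMap.snd ℝ ℝ ℝ)
  have hT : (fun p : ℝ × ℝ => (a * p.1 + b * p.2, b * p.1 - a * p.2)) = T := by
    ext p <;> simp [T]
  rw [hT]
  apply Measure.ext_of_charFunDual
  ext L
  rw [charFunDual_map, charFunDual_prod, charFunDual_prod]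
  simp only [charFunDual_gaussianReal_standard, ← Complex.exp_add]
  congr 1
  have hL : ∀ x y : ℝ, L (x, y) = x * L (1, 0) + y * L (0, 1) := by
    intro x y
    have : (x, y) = x • ((1, 0) : ℝ × ℝ) + y • ((0, 1) : ℝ × ℝ) := by ext <;> simp
    rw [this, map_add, map_smul, map_smul]; simp
  have h1 : T (1, 0) = (a, b) := by simp [T]
  have h2 : T (0, 1) = (b, -a) := by simp [T]
  simp only [ContinuousLinearMap.comp_apply, ContinuousLinearMap.inl_apply,
    ContinuousLinearMap.inr_apply, h1, h2]
  rw [hL a b, hL b (-a)]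
  have hc : (a : ℂ) ^ 2 + (b : ℂ) ^ 2 = 1 := by exact_mod_cast h
  push_cast
  linear_combination (-(L (1, 0) : ℂ) ^ 2 / 2 - (L (0, 1) : ℂ) ^ 2 / 2) * hc

lemma measurePreserving_rotate {ι : Type*} [Fintype ι] {a b : ℝ} (h : a ^ 2 + b ^ 2 = 1) :
    MeasurePreserving (fun p : (ι → ℝ) × (ι → ℝ) => (a • p.1 + b • p.2, b • p.1 - a • p.2))
      ((gaussianPi ι).prod (gaussianPi ι)) ((gaussianPi ι).prod (gaussianPi ι)) := by
  have e := measurePreserving_arrowProdEquivProdArrow ℝ ℝ ι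
    (fun _ => gaussianReal 0 1) (fun _ => gaussianReal 0 1)
  have hp := measurePreserving_pi (fun _ : ι => (gaussianReal 0 1).prod (gaussianReal 0 1))
    (fun _ : ι => (gaussianReal 0 1).prod (gaussianReal 0 1))
    (fun _ => measurePreserving_rotate_gaussianReal h)
  have := (e.comp hp).comp (e.symm)
  exact this

/-- The standard Gaussian measure on a product index set is the law of independent Gaussian
vectors. -/
lemma measurePreserving_curry_gaussianPi (κ ι : Type*) [Fintype κ] [Fintype ι] :
    MeasurePreserving (fun (f : κ × ι → ℝ) (k : κ) (i : ι) => f (k, i)) (gaussianPi (κ × ι))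
      (Measure.pi fun _ : κ => gaussianPi ι) := by
  refine ⟨by fun_prop, ?_⟩
  have h := Measure.infinitePi_map_curry (ι := κ) (κ := ι) (fun _ _ => gaussianReal 0 1)
  simp only [Measure.infinitePi_eq_pi] at h
  exact h

lemma gaussianReal_anticoncentration {κ s c τ : ℝ} (hs : 0 < s) (hτ : s ≤ τ) (hκ : 0 ≤ κ) :
    gaussianReal 0 1 {ξ | |c + τ * ξ| ≤ κ} ≤ ENNReal.ofReal (2 * κ / (√(2 * Real.pi) * s)) := by
  have hτ0 : 0 < τ := hs.trans_le hτ
  have hsub : {ξ : ℝ | |c + τ * ξ| ≤ κ} ⊆ Set.Icc ((-κ - c) / τ) ((κ - c) / τ) := by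
    intro ξ hξ
    have := abs_le.1 (show |c + τ * ξ| ≤ κ from hξ)
    constructor
    · rw [div_le_iff₀ hτ0]; linarith
    · rw [le_div_iff₀ hτ0]; linarith
  refine (measure_mono hsub).trans ?_
  rw [gaussianReal_apply _ one_ne_zero]
  calc ∫⁻ x in Set.Icc ((-κ - c) / τ) ((κ - c) / τ), gaussianPDF 0 1 x
      ≤ ∫⁻ x in Set.Icc ((-κ - c) / τ) ((κ - c) / τ), ENNReal.ofReal (√(2 * Real.pi))⁻¹ := by
        refine lintegral_mono fun x => ?_
        rw [gaussianPDF, gaussianPDFReal_def]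
        refine ENNReal.ofReal_le_ofReal ?_
        simp only [NNReal.coe_one, mul_one, sub_zero]
        refine mul_le_of_le_one_right (by positivity) (Real.exp_le_one_iff.2 ?_)
        have := sq_nonneg x
        linarith
    _ = ENNReal.ofReal (2 * κ / (√(2 * Real.pi) * τ)) := by
        rw [lintegral_const, Measure.restrict_apply_univ, Real.volume_Icc,
          ← ENNReal.ofReal_mul (by positivity)]
        congr 1
        field_simp
        ring
    _ ≤ _ := by
        refine ENNReal.ofReal_le_ofReal ?_
        gcongr

/-- The component along `e` is a standard Gaussian independent of the orthogonal part, so it can be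
redrawn. Integrating the redrawn coordinate amounts to conditioning on everything else. -/
lemma map_resample_direction {E : Type*} [NormedAddCommGroup E] [InnerProductSpace ℝ E]
    [FiniteDimensional ℝ E] [MeasurableSpace E] [BorelSpace E] {e : E} (he : ‖e‖ = 1) :
    ((stdGaussian E).prod (gaussianReal 0 1)).map
      (fun p : E × ℝ => p.1 + (p.2 - inner ℝ e p.1) • e) = stdGaussian E := by
  have := (FiniteDimensional.proper ℝ E)
  have : SecondCountableTopology E := secondCountable_of_proper
  let T : E × ℝ →L[ℝ] E := ContinuousLinearMap.fst ℝ E ℝ +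
    (ContinuousLinearMap.snd ℝ E ℝ - (innerSL ℝ e).comp (ContinuousLinearMap.fst ℝ E ℝ)).smulRight e
  have hT : (fun p : E × ℝ => p.1 + (p.2 - inner ℝ e p.1) • e) = T := by
    ext p; simp [T]
  rw [hT]
  apply Measure.ext_of_charFun
  ext t
  rw [charFun_eq_charFunDual_toDualMap, charFunDual_map, charFunDual_prod,
    charFunDual_gaussianReal_standard, ← charFun_toDual_symm_eq_charFunDual, charFun_stdGaussian,
    charFun_stdGaussian, ← Complex.exp_add]
  have h1 : (InnerProductSpace.toDual ℝ E).symm (((InnerProductSpace.toDualMap ℝ E t).comp T).comp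
      (.inl ℝ E ℝ)) = t - (inner ℝ t e) • e := by
    rw [LinearIsometryEquiv.symm_apply_eq]
    ext x
    simp [T, inner_smul_right]
    ring
  have h2 : ((InnerProductSpace.toDualMap ℝ E t).comp T).comp (.inr ℝ E ℝ) 1 = inner ℝ t e := by
    simp [T]
  rw [h1, h2]
  have h3 : ‖t - (inner ℝ t e) • e‖ ^ 2 = ‖t‖ ^ 2 - (inner ℝ t e) ^ 2 := by
    rw [norm_sub_sq_real, inner_smul_right, norm_smul, he, Real.norm_eq_abs, mul_one, sq_abs]
    ring
  congr 1
  rw [← Complex.ofReal_pow, h3]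
  push_cast
  ring

/-- Small ball estimate for a triangular family of Gaussian linear forms: each `w j` has component
at least `s` along a unit vector orthogonal to all earlier ones. -/
lemma stdGaussian_smallBall {E : Type*} [NormedAddCommGroup E] [InnerProductSpace ℝ E]
    [FiniteDimensional ℝ E] [MeasurableSpace E] [BorelSpace E] {J : Type*} [LinearOrder J]
    (w : J → E) {κ s : ℝ} (hκ : 0 ≤ κ) (hs : 0 < s) (S : Finset J)
    (h : ∀ j ∈ S, ∃ e : E, ‖e‖ = 1 ∧ (∀ i ∈ S, i < j → inner ℝ e (w i) = 0) ∧
      s ≤ inner ℝ e (w j)) :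
    stdGaussian E {x | ∀ j ∈ S, |inner ℝ x (w j)| ≤ κ}
      ≤ ENNReal.ofReal (2 * κ / (√(2 * Real.pi) * s)) ^ S.card := by
  induction S using Finset.induction_on_max with
  | empty => simp
  | insert a S ha ih =>
    have haS : a ∉ S := fun h => lt_irrefl _ (ha a h)
    obtain ⟨e, he, horth, hse⟩ := h a (Finset.mem_insert_self a S)
    have horth' : ∀ i ∈ S, inner ℝ e (w i) = 0 := fun i hi =>
      horth i (Finset.mem_insert_of_mem hi) (ha i hi)
    have ih' := ih fun j hj => by
      obtain ⟨e, h1, h2, h3⟩ := h j (Finset.mem_insert_of_mem hj)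
      exact ⟨e, h1, fun i hi => h2 i (Finset.mem_insert_of_mem hi), h3⟩
    have hmS : ∀ S : Finset J, MeasurableSet {x : E | ∀ j ∈ S, |inner ℝ x (w j)| ≤ κ} := by
      intro S
      have : {x : E | ∀ j ∈ S, |inner ℝ x (w j)| ≤ κ} =
          ⋂ j ∈ S, {x : E | |inner ℝ x (w j)| ≤ κ} := by ext; simp
      rw [this]
      refine Finset.measurableSet_biInter _ fun j _ => ?_
      exact (isClosed_le (by fun_prop) continuous_const).measurableSet
    rw [Finset.card_insert_of_notMem haS, pow_succ]
    -- Redraw the component along the direction `e` of the largest index `a`. The earlier forms do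
    -- not see it, while the last form becomes `c + τ ξ` with `τ ≥ s`, so anticoncentration gives
    -- one more factor.
    conv_lhs => rw [← map_resample_direction he]
    have : SecondCountableTopology E :=
      have := FiniteDimensional.proper ℝ E
      secondCountable_of_proper
    have hmeas : Measurable (fun p : E × ℝ => p.1 + (p.2 - inner ℝ e p.1) • e) := by fun_prop
    rw [Measure.map_apply hmeas (hmS _), Measure.prod_apply (hmeas (hmS _))]
    calc _ ≤ ∫⁻ x, {x | ∀ j ∈ S, |inner ℝ x (w j)| ≤ κ}.indicator
            (fun _ => ENNReal.ofReal (2 * κ / (√(2 * Real.pi) * s))) x ∂(stdGaussian E) := by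
          refine lintegral_mono fun x => ?_
          by_cases hx : x ∈ {x | ∀ j ∈ S, |inner ℝ x (w j)| ≤ κ}
          · rw [Set.indicator_of_mem hx]
            refine le_trans (measure_mono ?_) (gaussianReal_anticoncentration
              (c := inner ℝ x (w a) - inner ℝ e x * inner ℝ e (w a)) hs hse hκ)
            intro ξ hξ
            have := hξ a (Finset.mem_insert_self a S)
            simp only [inner_add_left, inner_smul_left] at this
            simp only [Set.mem_ofPred_eq]
            convert this using 2
            simp
            ring
          · rw [Set.indicator_of_notMem hx]
            refine le_of_eq (measure_mono_null (t := ∅) (fun ξ hξ => hx fun j hj => ?_) (by simp))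
            have := hξ j (Finset.mem_insert_of_mem hj)
            simpa only [inner_add_left, inner_smul_left, horth' j hj, mul_zero, add_zero] using this
      _ ≤ _ := by
          rw [lintegral_indicator (hmS S), lintegral_const, Measure.restrict_apply_univ, mul_comm]
          gcongr

/-- Small ball estimate for the row forms `⟨∑ₖ uⱼₖ Wₖ, σⱼ⟩ / √N` of independent Gaussian
matrices `Wₖ`. -/
lemma smallBall_rows {T : Type*} [Fintype T] {M N m : ℕ} (u : Fin m → T → ℝ)
    (σ : Fin m → Fin N → ℝ) {κ s : ℝ} (hκ : 0 ≤ κ) (hs : 0 < s)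
    (h : ∀ j, ∃ (v : T → ℝ) (τ : Fin N → ℝ), (∑ k, v k ^ 2) * (∑ l, τ l ^ 2) = 1 ∧
      (∀ i < j, (∑ k, v k * u i k) * (∑ l, τ l * σ i l) = 0) ∧
      s ≤ (∑ k, v k * u j k) * (∑ l, τ l * σ j l) / √N) :
    (Measure.pi fun _ : T => disorderLaw M N)
      {W | ∀ j (i : Fin M), |(∑ l, (∑ k, u j k * W k (i, l)) * σ j l) / √N| ≤ κ}
      ≤ ENNReal.ofReal (2 * κ / (√(2 * Real.pi) * s)) ^ (m * M) := by
  classical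
  -- In the lexicographic order all forms of earlier points precede those of point `j`. Forms on
  -- different rows have disjoint supports, so orthogonality has to come from the hypothesis only
  -- between forms on the same row.
  let w : Fin m ×ₗ Fin M → EuclideanSpace ℝ (T × (Fin M × Fin N)) := fun p =>
    WithLp.toLp 2 fun q => if q.2.1 = (ofLex p).2 then
      u (ofLex p).1 q.1 * σ (ofLex p).1 q.2.2 / √N else 0
  have hmp := measurePreserving_curry_gaussianPi T (Fin M × Fin N)
  have hset : {W : T → Disorder M N |
      ∀ j (i : Fin M), |(∑ l, (∑ k, u j k * W k (i, l)) * σ j l) / √N| ≤ κ} =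
      {W | ∀ j ∈ (Finset.univ : Finset (Fin m ×ₗ Fin M)),
        |inner ℝ (WithLp.toLp 2 fun q : T × (Fin M × Fin N) => W q.1 q.2) (w j)| ≤ κ} := by
    ext W
    simp only [Set.mem_ofPred_eq, Finset.mem_univ, true_imp_iff]
    have key : ∀ p : Fin m ×ₗ Fin M,
        inner ℝ (WithLp.toLp 2 fun q : T × (Fin M × Fin N) => W q.1 q.2) (w p) =
        (∑ l, (∑ k, u (ofLex p).1 k * W k ((ofLex p).2, l)) * σ (ofLex p).1 l) / √N := by
      intro p
      simp only [PiLp.inner_apply, w, Fintype.sum_prod_type]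
      rw [Finset.sum_div]
      simp only [Finset.sum_mul, Finset.sum_div]
      rw [Finset.sum_comm (s := (Finset.univ : Finset (Fin N)))]
      refine Finset.sum_congr rfl fun k _ => ?_
      rw [Finset.sum_eq_single (ofLex p).2]
      · refine Finset.sum_congr rfl fun l _ => ?_
        simp
        ring
      · intro i _ hi
        simp [hi]
      · simp
    constructor
    · intro hW p
      rw [key]
      exact hW _ _
    · intro hW j i
      have := hW (toLex (j, i))
      rw [key] at this
      exact this
  have hcl : ∀ S : Finset (Fin m ×ₗ Fin M), MeasurableSet
      {x : EuclideanSpace ℝ (T × (Fin M × Fin N)) | ∀ j ∈ S, |inner ℝ x (w j)| ≤ κ} := by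
    intro S
    have : {x : EuclideanSpace ℝ (T × (Fin M × Fin N)) | ∀ j ∈ S, |inner ℝ x (w j)| ≤ κ} =
        ⋂ j ∈ S, {x | |inner ℝ x (w j)| ≤ κ} := by ext; simp
    rw [this]
    refine Finset.measurableSet_biInter _ fun j _ => ?_
    exact (isClosed_le (by fun_prop) continuous_const).measurableSet
  have hcard : m * M = (Finset.univ : Finset (Fin m ×ₗ Fin M)).card := by
    rw [Finset.card_univ, Fintype.card_lex, Fintype.card_prod, Fintype.card_fin, Fintype.card_fin]
  have hdis : disorderLaw M N = gaussianPi (Fin M × Fin N) := rfl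
  have hrepr : {W : T → Disorder M N | ∀ j ∈ (Finset.univ : Finset (Fin m ×ₗ Fin M)),
        |inner ℝ (WithLp.toLp 2 fun q : T × (Fin M × Fin N) => W q.1 q.2) (w j)| ≤ κ} =
      (fun W : T → Disorder M N => WithLp.toLp 2 fun q : T × (Fin M × Fin N) => W q.1 q.2) ⁻¹'
      {x | ∀ j ∈ (Finset.univ : Finset (Fin m ×ₗ Fin M)), |inner ℝ x (w j)| ≤ κ} := rfl
  have hmW : Measurable
      (fun W : T → Disorder M N => WithLp.toLp 2 fun q : T × (Fin M × Fin N) => W q.1 q.2) := by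
    fun_prop
  rw [hset, hdis, hcard, hrepr, ← hmp.map_eq, ← Measure.map_apply hmW (hcl _),
    Measure.map_map hmW hmp.measurable]
  have : ((fun W : T → Disorder M N => WithLp.toLp 2 fun q : T × (Fin M × Fin N) => W q.1 q.2) ∘
      fun (f : T × (Fin M × Fin N) → ℝ) (k : T) (i : Fin M × Fin N) => f (k, i)) =
      WithLp.toLp 2 := rfl
  rw [this, gaussianPi, map_pi_eq_stdGaussian]
  refine stdGaussian_smallBall w hκ hs _ fun p _ => ?_
  obtain ⟨v, τ, hn, ho, hc⟩ := h (ofLex p).1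
  -- The rank-one tensor `v ⊗ τ` placed in the row of `p`. Its pairings factor into a sum over the
  -- noise index and a sum over space, so either factor may supply the orthogonality.
  let e : EuclideanSpace ℝ (T × (Fin M × Fin N)) :=
    WithLp.toLp 2 fun q => if q.2.1 = (ofLex p).2 then v q.1 * τ q.2.2 else 0
  have hew : ∀ p' : Fin m ×ₗ Fin M, inner ℝ e (w p') = if (ofLex p').2 = (ofLex p).2 then
      (∑ k, v k * u (ofLex p').1 k) * (∑ l, τ l * σ (ofLex p').1 l) / √N else 0 := by
    intro p'
    simp only [PiLp.inner_apply, w, e, Fintype.sum_prod_type]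
    rw [Finset.sum_mul_sum, Finset.sum_div]
    split_ifs with hp
    · refine Finset.sum_congr rfl fun k _ => ?_
      rw [Finset.sum_eq_single (ofLex p).2, Finset.sum_div]
      · refine Finset.sum_congr rfl fun l _ => ?_
        simp [hp]
        ring
      · intro i _ hi
        simp [hi]
      · simp
    · refine Finset.sum_eq_zero fun k _ => Finset.sum_eq_zero fun i _ =>
        Finset.sum_eq_zero fun l _ => ?_
      by_cases hi : i = (ofLex p).2
      · subst hi; simp [Ne.symm hp]
      · simp [hi]
  refine ⟨e, ?_, ?_, ?_⟩
  · rw [EuclideanSpace.norm_eq, Real.sqrt_eq_one, ← hn]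
    simp only [e, Fintype.sum_prod_type, Real.norm_eq_abs, sq_abs]
    rw [Finset.sum_mul_sum]
    refine Finset.sum_congr rfl fun k _ => ?_
    rw [Finset.sum_eq_single (ofLex p).2]
    · simp [mul_pow]
    · intro i _ hi
      simp [hi]
    · simp
  · intro p' _ hp'
    rw [hew]
    split_ifs with hp
    · rcases (Prod.Lex.lt_iff).1 hp' with h1 | ⟨h1, h2⟩
      · rw [ho _ h1, zero_div]
      · exact absurd h2 (by rw [hp]; exact lt_irrefl _)
    · rfl
  · rw [hew, if_pos rfl]
    exact hc

/-! ### Reversible transfer operators and a lower bound for path probabilities. -/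

section Transfer

variable {ι : Type*} [Fintype ι]

lemma lintegral_pair_swap {a b : ℝ} (h : a ^ 2 + b ^ 2 = 1)
    {F : (ι → ℝ) × (ι → ℝ) → ENNReal} (hF : Measurable F) :
    ∫⁻ x, ∫⁻ z, F (x, a • x + b • z) ∂(gaussianPi ι) ∂(gaussianPi ι) =
      ∫⁻ x, ∫⁻ z, F (a • x + b • z, x) ∂(gaussianPi ι) ∂(gaussianPi ι) := by
  rw [lintegral_lintegral (f := fun x z => F (x, a • x + b • z)) (by fun_prop),
    lintegral_lintegral (f := fun x z => F (a • x + b • z, x)) (by fun_prop),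
    ← (measurePreserving_rotate h).lintegral_comp (f := fun p => F (p.1, a • p.1 + b • p.2))
      (by fun_prop)]
  refine lintegral_congr fun p => ?_
  congr 2
  ext i
  simp
  linear_combination (p.1 i) * h

lemma lintegral_step {a b : ℝ} (h : a ^ 2 + b ^ 2 = 1) {f : (ι → ℝ) → ENNReal}
    (hf : Measurable f) :
    ∫⁻ x, ∫⁻ z, f (a • x + b • z) ∂(gaussianPi ι) ∂(gaussianPi ι) = ∫⁻ x, f x ∂(gaussianPi ι) := by
  rw [← lintegral_pair_swap h (F := fun p => f p.1) (by fun_prop)]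
  simp

lemma sq_lintegral_le {α : Type*} [MeasurableSpace α] (μ : Measure α) [IsProbabilityMeasure μ]
    {f : α → ENNReal} (hf : Measurable f) : (∫⁻ x, f x ∂μ) ^ 2 ≤ ∫⁻ x, f x * f x ∂μ := by
  have h := ENNReal.lintegral_mul_le_Lp_mul_Lq μ (p := 2) (q := 2)
    (Real.HolderConjugate.two_two) hf.aemeasurable (g := fun _ => 1) aemeasurable_const
  simp only [Pi.mul_apply, mul_one, ENNReal.one_rpow, lintegral_const, measure_univ] at h
  calc (∫⁻ x, f x ∂μ) ^ 2 ≤ ((∫⁻ x, f x ^ (2 : ℝ) ∂μ) ^ (1 / 2 : ℝ)) ^ 2 := by gcongr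
    _ = ∫⁻ x, f x ^ (2 : ℝ) ∂μ := by
        rw [← ENNReal.rpow_natCast, ← ENNReal.rpow_mul]; norm_num
    _ = _ := by
        refine lintegral_congr fun x => ?_
        rw [ENNReal.rpow_two, sq]

/-- The transition operator of the chain `x ↦ a x + b z`, restricted to transitions in `R`. -/
noncomputable def transfer (a b : ℝ) (R : Set ((ι → ℝ) × (ι → ℝ))) (h : (ι → ℝ) → ENNReal)
    (x : ι → ℝ) : ENNReal :=
  ∫⁻ z, R.indicator 1 (x, a • x + b • z) * h (a • x + b • z) ∂(gaussianPi ι)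

variable {a b : ℝ} {R : Set ((ι → ℝ) × (ι → ℝ))}

lemma measurable_transfer (hR : MeasurableSet R) {h : (ι → ℝ) → ENNReal} (hh : Measurable h) :
    Measurable (transfer a b R h) := by
  have h1 : Measurable (R.indicator (1 : (ι → ℝ) × (ι → ℝ) → ENNReal)) :=
    measurable_one.indicator hR
  unfold transfer
  refine Measurable.lintegral_prod_right
    (f := fun x z => R.indicator 1 (x, a • x + b • z) * h (a • x + b • z)) ?_
  exact (h1.comp (by fun_prop)).mul (hh.comp (by fun_prop))

/-- Self-adjointness of the operator: the chain is reversible and `R` is symmetric. -/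
lemma lintegral_mul_transfer (h : a ^ 2 + b ^ 2 = 1) (hR : MeasurableSet R)
    (hsymm : ∀ x y, (x, y) ∈ R → (y, x) ∈ R) {f g : (ι → ℝ) → ENNReal} (hf : Measurable f)
    (hg : Measurable g) :
    ∫⁻ x, f x * transfer a b R g x ∂(gaussianPi ι) =
      ∫⁻ x, transfer a b R f x * g x ∂(gaussianPi ι) := by
  have h1 : Measurable (R.indicator (1 : (ι → ℝ) × (ι → ℝ) → ENNReal)) :=
    measurable_one.indicator hR
  have h2 : ∀ x y, R.indicator (1 : (ι → ℝ) × (ι → ℝ) → ENNReal) (x, y) = R.indicator 1 (y, x) := by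
    intro x y
    by_cases hxy : (x, y) ∈ R
    · rw [Set.indicator_of_mem hxy, Set.indicator_of_mem (hsymm _ _ hxy)]; rfl
    · rw [Set.indicator_of_notMem hxy, Set.indicator_of_notMem fun h => hxy (hsymm _ _ h)]
  have e1 : ∀ x, f x * transfer a b R g x = ∫⁻ z, (fun p : (ι → ℝ) × (ι → ℝ) =>
      f p.1 * (R.indicator 1 p * g p.2)) (x, a • x + b • z) ∂(gaussianPi ι) := by
    intro x
    rw [transfer, ← lintegral_const_mul]
    exact (h1.comp (by fun_prop)).mul (hg.comp (by fun_prop))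
  have e2 : ∀ x, transfer a b R f x * g x = ∫⁻ z, (fun p : (ι → ℝ) × (ι → ℝ) =>
      f p.1 * (R.indicator 1 p * g p.2)) (a • x + b • z, x) ∂(gaussianPi ι) := by
    intro x
    rw [transfer, ← lintegral_mul_const]
    · refine lintegral_congr fun z => ?_
      simp only
      rw [h2 x]
      ring
    · exact (h1.comp (by fun_prop)).mul (hf.comp (by fun_prop))
  simp_rw [e1, e2]
  exact lintegral_pair_swap h ((hf.comp measurable_fst).mul (h1.mul (hg.comp measurable_snd)))

lemma measurable_transfer_iterate (hR : MeasurableSet R) (k : ℕ) :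
    Measurable ((transfer a b R)^[k] 1) := by
  induction k with
  | zero => exact measurable_one
  | succ k ih => rw [Function.iterate_succ_apply']; exact measurable_transfer hR ih

lemma lintegral_transfer_iterate_add (h : a ^ 2 + b ^ 2 = 1) (hR : MeasurableSet R)
    (hsymm : ∀ x y, (x, y) ∈ R → (y, x) ∈ R) (j k : ℕ) :
    ∫⁻ x, (transfer a b R)^[j] 1 x * (transfer a b R)^[k] 1 x ∂(gaussianPi ι) =
      ∫⁻ x, (transfer a b R)^[j + k] 1 x ∂(gaussianPi ι) := by
  induction k generalizing j with
  | zero => simp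
  | succ k ih =>
    rw [Function.iterate_succ_apply', lintegral_mul_transfer h hR hsymm
      (measurable_transfer_iterate hR j) (measurable_transfer_iterate hR k),
      ← Function.iterate_succ_apply' (transfer a b R) j, ih]
    congr! 3
    omega

/-- Blakley–Roy type bound for paths whose length is a power of two. -/
lemma pow_le_lintegral_transfer_iterate (h : a ^ 2 + b ^ 2 = 1) (hR : MeasurableSet R)
    (hsymm : ∀ x y, (x, y) ∈ R → (y, x) ∈ R) (r : ℕ) :
    (∫⁻ x, transfer a b R 1 x ∂(gaussianPi ι)) ^ (2 ^ r) ≤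
      ∫⁻ x, (transfer a b R)^[2 ^ r] 1 x ∂(gaussianPi ι) := by
  induction r with
  | zero => simp
  | succ r ih =>
    -- With `P` the operator and `k = 2 ^ r`, Cauchy–Schwarz gives `(∫ P^k 1)² ≤ ∫ (P^k 1)²`, and
    -- self-adjointness turns the right side into `∫ P^(2k) 1`.
    rw [pow_succ 2 r, pow_mul]
    calc _ ≤ (∫⁻ x, (transfer a b R)^[2 ^ r] 1 x ∂(gaussianPi ι)) ^ 2 := by gcongr
      _ ≤ _ := sq_lintegral_le _ (measurable_transfer_iterate hR _)
      _ = _ := by rw [lintegral_transfer_iterate_add h hR hsymm, mul_two]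

end Transfer

/-! ### The chain as an explicit linear function of its noise. -/

section ChainState

variable {ι : Type*} {a b : ℝ} {R : Set ((ι → ℝ) × (ι → ℝ))}

/-- Coefficient of the `i`-th noise vector in the `k`-th state of the chain. -/
def chainCoeff (a b : ℝ) : ℕ → ℕ → ℝ
  | 0, i => if i = 0 then 1 else 0
  | k + 1, i => if i = k + 1 then b else a * chainCoeff a b k i

/-- The `k`-th state of the chain driven by the noise `W`. -/
def chainState (a b : ℝ) {n : ℕ} (W : Fin (n + 1) → ι → ℝ) (k : ℕ) : ι → ℝ :=
  ∑ i : Fin (n + 1), chainCoeff a b k i • W i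

lemma chainCoeff_of_lt {k i : ℕ} (h : k < i) : chainCoeff a b k i = 0 := by
  induction k with
  | zero => simp [chainCoeff, Nat.pos_iff_ne_zero.1 h]
  | succ k ih => rw [chainCoeff, if_neg (by omega), ih (by omega), mul_zero]

lemma chainState_zero {n : ℕ} (W : Fin (n + 1) → ι → ℝ) : chainState a b W 0 = W 0 := by
  rw [chainState, Finset.sum_eq_single 0]
  · simp [chainCoeff]
  · intro i _ hi
    rw [chainCoeff, if_neg (by simpa using hi), zero_smul]
  · simp

lemma chainState_succ {n : ℕ} (W : Fin (n + 1) → ι → ℝ) (k : Fin n) :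
    chainState a b W (k + 1) = a • chainState a b W k + b • W k.succ := by
  have : ∀ i : Fin (n + 1), chainCoeff a b (k + 1) i • W i =
      a • chainCoeff a b k i • W i + if i = k.succ then b • W i else 0 := by
    intro i
    rw [chainCoeff]
    by_cases hi : i = k.succ
    · subst hi
      simp [chainCoeff_of_lt]
    · rw [if_neg (fun h => hi (Fin.ext (by simpa using h))), if_neg hi, add_zero, mul_smul]
  rw [chainState, Finset.sum_congr rfl fun i _ => this i, Finset.sum_add_distrib,
    ← Finset.smul_sum, Finset.sum_ite_eq' Finset.univ k.succ]
  simp [chainState]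

/-- The Markov property at the first step: the first noise vector is absorbed into the initial
state. -/
lemma chainState_cons_succ {n : ℕ} (x : ι → ℝ) (Z : Fin (n + 1) → ι → ℝ) (k : ℕ) (hk : k ≤ n) :
    chainState a b (Fin.cons x Z : Fin (n + 2) → ι → ℝ) (k + 1) =
      chainState a b (Fin.cons (a • x + b • Z 0) (Fin.tail Z) : Fin (n + 1) → ι → ℝ) k := by
  induction k with
  | zero =>
    have := chainState_succ (a := a) (b := b) (Fin.cons x Z : Fin (n + 2) → ι → ℝ) 0
    simp only [Fin.val_zero] at this
    rw [this, chainState_zero, chainState_zero]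
    simp
  | succ k ih =>
    have h1 := chainState_succ (a := a) (b := b) (Fin.cons x Z : Fin (n + 2) → ι → ℝ)
      ⟨k + 1, by omega⟩
    have h2 := chainState_succ (a := a) (b := b)
      (Fin.cons (a • x + b • Z 0) (Fin.tail Z) : Fin (n + 1) → ι → ℝ) ⟨k, by omega⟩
    simp only at h1 h2
    rw [h1, h2, ih (by omega), Fin.cons_succ, ← Fin.succ_mk _ _ (by omega : k < n), Fin.cons_succ]
    rfl

/-- The set of noise vectors for which all `n` transitions of the chain lie in `R`. -/
def pathSet (a b : ℝ) (R : Set ((ι → ℝ) × (ι → ℝ))) (n : ℕ) : Set (Fin (n + 1) → ι → ℝ) :=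
  {W | ∀ k < n, (chainState a b W k, chainState a b W (k + 1)) ∈ R}

lemma measurable_chainState {n : ℕ} (k : ℕ) :
    Measurable fun W : Fin (n + 1) → ι → ℝ => chainState a b W k := by
  unfold chainState; fun_prop

lemma measurableSet_pathSet (hR : MeasurableSet R) (n : ℕ) : MeasurableSet (pathSet a b R n) := by
  have : pathSet a b R n = ⋂ k ∈ Finset.range n,
      (fun W : Fin (n + 1) → ι → ℝ => (chainState a b W k, chainState a b W (k + 1))) ⁻¹' R := by
    ext; simp [pathSet]
  rw [this]
  refine Finset.measurableSet_biInter _ fun k _ => ?_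
  exact ((measurable_chainState k).prodMk (measurable_chainState (k + 1))) hR

lemma mem_pathSet_cons_succ {n : ℕ} (x : ι → ℝ) (Z : Fin (n + 1) → ι → ℝ) :
    (Fin.cons x Z : Fin (n + 2) → ι → ℝ) ∈ pathSet a b R (n + 1) ↔
      (x, a • x + b • Z 0) ∈ R ∧
      (Fin.cons (a • x + b • Z 0) (Fin.tail Z) : Fin (n + 1) → ι → ℝ) ∈ pathSet a b R n := by
  have h0 := chainState_zero (a := a) (b := b) (Fin.cons x Z : Fin (n + 2) → ι → ℝ)
  have h1 := chainState_cons_succ (a := a) (b := b) x Z 0 (by omega)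
  rw [chainState_zero] at h1
  simp only [Fin.cons_zero] at h0 h1
  constructor
  · intro h
    refine ⟨?_, fun k hk => ?_⟩
    · have := h 0 (by omega)
      rwa [h0, h1] at this
    · have := h (k + 1) (by omega)
      rwa [chainState_cons_succ _ _ _ (by omega), chainState_cons_succ _ _ _ (by omega)] at this
  · rintro ⟨h2, h3⟩ k hk
    rcases k with _ | k
    · rwa [h0, h1]
    · rw [chainState_cons_succ _ _ _ (by omega), chainState_cons_succ _ _ _ (by omega)]
      exact h3 k (by omega)

end ChainState

/-! ### Path probabilities and positive correlation of one step. -/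

section PathMeasure

variable {ι : Type*} [Fintype ι] {a b : ℝ} {R : Set ((ι → ℝ) × (ι → ℝ))}

lemma measurePreserving_cons_gaussianPi (n : ℕ) :
    MeasurePreserving (fun p : (ι → ℝ) × (Fin n → ι → ℝ) => (Fin.cons p.1 p.2 : Fin (n + 1) → ι → ℝ))
      ((gaussianPi ι).prod (Measure.pi fun _ => gaussianPi ι)) (Measure.pi fun _ => gaussianPi ι) := by
  have := (measurePreserving_piFinSuccAbove (fun _ : Fin (n + 1) => gaussianPi ι) 0).symm
  convert this using 1
  ext p : 1
  simp [MeasurableEquiv.piFinSuccAbove]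
  rfl

lemma measure_pathSet_cons (hR : MeasurableSet R) (n : ℕ) (x : ι → ℝ) :
    (Measure.pi fun _ : Fin n => gaussianPi ι)
      {Z | (Fin.cons x Z : Fin (n + 1) → ι → ℝ) ∈ pathSet a b R n} = (transfer a b R)^[n] 1 x := by
  have hcons : ∀ (n : ℕ), Measurable (fun p : (ι → ℝ) × (Fin n → ι → ℝ) =>
      (Fin.cons p.1 p.2 : Fin (n + 1) → ι → ℝ)) := fun n =>
    (measurePreserving_cons_gaussianPi n).measurable
  induction n generalizing x with
  | zero => simp [pathSet]
  | succ n ih =>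
    have hm : MeasurableSet {Z : Fin (n + 1) → ι → ℝ |
        (Fin.cons x Z : Fin (n + 2) → ι → ℝ) ∈ pathSet a b R (n + 1)} :=
      ((hcons (n + 1)).comp measurable_prodMk_left) (measurableSet_pathSet hR _)
    rw [← (measurePreserving_cons_gaussianPi n).measure_preimage hm.nullMeasurableSet,
      Measure.prod_apply ((measurePreserving_cons_gaussianPi n).measurable hm),
      Function.iterate_succ_apply', transfer]
    refine lintegral_congr fun z => ?_
    rw [← ih]
    by_cases hz : (x, a • x + b • z) ∈ R
    · rw [Set.indicator_of_mem hz, Pi.one_apply, one_mul]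
      congr 1
      ext Z
      simp [mem_pathSet_cons_succ, hz]
    · rw [Set.indicator_of_notMem hz, zero_mul]
      refine measure_mono_null (t := ∅) (fun Z hZ => hz ?_) (by simp)
      have := (mem_pathSet_cons_succ x (Fin.cons z Z : Fin (n + 1) → ι → ℝ)).1 hZ
      simpa using this.1

lemma measure_pathSet (hR : MeasurableSet R) (n : ℕ) :
    (Measure.pi fun _ : Fin (n + 1) => gaussianPi ι) (pathSet a b R n) =
      ∫⁻ x, (transfer a b R)^[n] 1 x ∂(gaussianPi ι) := by
  rw [← (measurePreserving_cons_gaussianPi n).measure_preimage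
    (measurableSet_pathSet hR n).nullMeasurableSet,
    Measure.prod_apply ((measurePreserving_cons_gaussianPi n).measurable (measurableSet_pathSet hR n))]
  exact lintegral_congr fun x => measure_pathSet_cons hR n x

/-- Consecutive states of the chain are positively correlated. -/
lemma sq_measure_le_lintegral_transfer (ha : 0 ≤ a) (hb : 0 < b) (h : a ^ 2 + b ^ 2 = 1)
    {E : Set (ι → ℝ)} (hE : MeasurableSet E) :
    gaussianPi ι E ^ 2 ≤ ∫⁻ x, transfer a b (E ×ˢ E) 1 x ∂(gaussianPi ι) := by
  have ha1 : a ≤ 1 := by nlinarith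
  -- Split the step of correlation `a` into two half steps of correlation `√a`. With `P'` the
  -- half-step operator, the right side is `∫ 1_E P' P' 1_E = ∫ (P' 1_E)² ≥ (∫ P' 1_E)²`, and `P'`
  -- preserves the mean.
  set a' := √a with ha'
  set b' := √(1 - a) with hb'
  have hsa : a' ^ 2 = a := Real.sq_sqrt ha
  have hsb : b' ^ 2 = 1 - a := Real.sq_sqrt (by linarith)
  have hab' : a' ^ 2 + b' ^ 2 = 1 := by rw [hsa, hsb]; ring
  have hm1 : Measurable (E.indicator (1 : (ι → ℝ) → ENNReal)) := measurable_one.indicator hE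
  set g : (ι → ℝ) → ENNReal := transfer a' b' Set.univ (E.indicator 1) with hg
  have hgm : Measurable g := measurable_transfer MeasurableSet.univ hm1
  -- The noise of two half steps is `a' b' z + b' z'`, of variance `(1 - a)(1 + a) = b ^ 2`.
  have hrot : (a' * b' / b) ^ 2 + (b' / b) ^ 2 = 1 := by
    field_simp
    rw [hsa, hsb]
    linarith
  have h1 : ∀ x, transfer a' b' Set.univ g x =
      ∫⁻ z, E.indicator 1 (a • x + b • z) ∂(gaussianPi ι) := by
    intro x
    rw [← lintegral_step hrot (f := fun z => E.indicator 1 (a • x + b • z))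
      (hm1.comp (by fun_prop))]
    rw [transfer]
    refine lintegral_congr fun z => ?_
    rw [hg, transfer]
    simp only [Set.indicator_univ, Pi.one_apply, one_mul]
    refine lintegral_congr fun z' => ?_
    congr 1
    ext i
    simp only [Pi.add_apply, Pi.smul_apply, smul_eq_mul]
    field_simp
    linear_combination (x i) * hsa
  have h2 : ∀ x, transfer a b (E ×ˢ E) 1 x = E.indicator 1 x * transfer a' b' Set.univ g x := by
    intro x
    rw [h1, transfer]
    by_cases hx : x ∈ E
    · rw [Set.indicator_of_mem hx, Pi.one_apply, one_mul]
      refine lintegral_congr fun z => ?_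
      by_cases hz : a • x + b • z ∈ E
      · simp [hx, hz]
      · simp [hx, hz]
    · simp [hx]
  have h3 : gaussianPi ι E = ∫⁻ x, g x ∂(gaussianPi ι) := by
    have : ∀ x, g x = ∫⁻ z, E.indicator 1 (a' • x + b' • z) ∂(gaussianPi ι) := by
      intro x; simp [hg, transfer]
    simp_rw [this]
    rw [lintegral_step hab' hm1, lintegral_indicator_one hE]
  simp_rw [h2]
  rw [lintegral_mul_transfer hab' MeasurableSet.univ (by simp) hm1 hgm, h3]
  exact sq_lintegral_le _ hgm

end PathMeasure

/-! ### Leading-order expansion of a polynomial at a noisy point. -/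

section PolynomialAlgebra

open MvPolynomial

variable {ι : Type*}

variable (ι) in
/-- Real polynomials of total degree less than `n`. -/
noncomputable def degreeLT (n : ℕ) : Submodule ℝ (MvPolynomial ι ℝ) :=
  restrictSupport ℝ {d | d.degree < n}

lemma degreeLT_mono {m n : ℕ} (h : m ≤ n) : degreeLT ι m ≤ degreeLT ι n :=
  restrictSupport_mono _ fun _ hd => lt_of_lt_of_le hd h

lemma monomial_mem_degreeLT {d : ι →₀ ℕ} {n : ℕ} (h : d.degree < n) :
    monomial d (1 : ℝ) ∈ degreeLT ι n :=
  (monomial_mem_restrictSupport ℝ).2 (Or.inl h)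

lemma X_mul_mem_degreeLT {n : ℕ} (i : ι) {p : MvPolynomial ι ℝ} (hp : p ∈ degreeLT ι n) :
    X i * p ∈ degreeLT ι (n + 1) := by
  have : degreeLT ι n ≤ (degreeLT ι (n + 1)).comap (LinearMap.mulLeft ℝ (X i : MvPolynomial ι ℝ)) := by
    rw [degreeLT, restrictSupport_eq_span, Submodule.span_le]
    rintro _ ⟨d, hd, rfl⟩
    change X i * monomial d (1 : ℝ) ∈ degreeLT ι (n + 1)
    rw [X, monomial_mul, one_mul]
    refine monomial_mem_degreeLT ?_
    have : d.degree < n := hd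
    simp only [map_add, Finsupp.degree_single]
    omega
  exact this hp

lemma mem_degreeLT_of_totalDegree_le {n : ℕ} {p : MvPolynomial ι ℝ} (hp : p.totalDegree ≤ n) :
    p ∈ degreeLT ι (n + 1) := by
  refine (mem_restrictSupport_iff ℝ).2 fun d hd => ?_
  have := le_totalDegree hd
  have h2 : d.degree = d.sum fun _ e => e := rfl
  have h3 : d.degree < n + 1 := by omega
  exact h3

variable (ι) in
/-- The span of the products `c x * e z` of polynomials with `c` of degree less than `n`. -/
noncomputable def lowerDegreeSpan (n : ℕ) : Submodule ℝ ((ι → ℝ) → (ι → ℝ) → ℝ) :=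
  Submodule.span ℝ {F | ∃ c ∈ degreeLT ι n, ∃ e : MvPolynomial ι ℝ,
    F = fun x z => eval x c * eval z e}

lemma lowerDegreeSpan_mono {m n : ℕ} (h : m ≤ n) : lowerDegreeSpan ι m ≤ lowerDegreeSpan ι n :=
  Submodule.span_mono fun _ ⟨c, hc, e, he⟩ => ⟨c, degreeLT_mono h hc, e, he⟩

lemma mul_mem_lowerDegreeSpan {n : ℕ} {c : MvPolynomial ι ℝ} (hc : c ∈ degreeLT ι n)
    (e : MvPolynomial ι ℝ) : (fun x z => eval x c * eval z e) ∈ lowerDegreeSpan ι n :=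
  Submodule.subset_span ⟨c, hc, e, rfl⟩

lemma step_mul_mem_lowerDegreeSpan (a b : ℝ) (i : ι) {n : ℕ} {F : (ι → ℝ) → (ι → ℝ) → ℝ}
    (hF : F ∈ lowerDegreeSpan ι n) :
    (fun x z => (a * x i + b * z i) * F x z) ∈ lowerDegreeSpan ι (n + 1) := by
  induction hF using Submodule.span_induction with
  | mem F hF =>
    obtain ⟨c, hc, e, rfl⟩ := hF
    have h1 := mul_mem_lowerDegreeSpan (Submodule.smul_mem _ a (X_mul_mem_degreeLT i hc)) e
    have h2 := mul_mem_lowerDegreeSpan (degreeLT_mono (Nat.le_succ n) hc) (b • (X i * e))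
    convert! Submodule.add_mem _ h1 h2 using 1
    ext x z
    simp
    ring
  | zero => simp only [Pi.zero_apply, mul_zero]; exact Submodule.zero_mem _
  | add F G _ _ h1 h2 =>
    convert! Submodule.add_mem _ h1 h2 using 1
    ext x z
    simp
    ring
  | smul r F _ h1 =>
    convert! Submodule.smul_mem _ r h1 using 1
    ext x z
    simp
    ring

/-- To leading order in `x`, the polynomial `f (a x + b z)` is `a ^ deg f * f x`. -/
lemma monomial_step_sub_mem (a b : ℝ) (d : ι →₀ ℕ) :
    (fun x z => eval (a • x + b • z) (monomial d (1 : ℝ)) -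
      a ^ d.degree * eval x (monomial d (1 : ℝ))) ∈ lowerDegreeSpan ι d.degree := by
  classical
  obtain ⟨n, hn⟩ : ∃ n, d.degree = n := ⟨_, rfl⟩
  induction n generalizing d with
  | zero =>
    rw [Finsupp.degree_eq_zero_iff] at hn
    subst hn
    simp only [map_zero, pow_zero, one_mul, monomial_zero', map_one, sub_self]
    exact Submodule.zero_mem _
  | succ n ih =>
    obtain ⟨i, hi⟩ : ∃ i, d i ≠ 0 := by
      by_contra! h
      have : d = 0 := Finsupp.ext h
      simp [this] at hn
    obtain ⟨d, rfl⟩ : ∃ d', d = Finsupp.single i 1 + d' :=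
      le_iff_exists_add.1 (Finsupp.single_le_iff.2 (Nat.one_le_iff_ne_zero.2 hi))
    have hd : d.degree = n := by
      simp only [map_add, Finsupp.degree_single] at hn
      omega
    have hX : monomial (Finsupp.single i 1 + d) (1 : ℝ) = X i * monomial d 1 := by
      rw [X, monomial_mul, one_mul]
    have h1 := step_mul_mem_lowerDegreeSpan a b i (ih d hd)
    have h2 := mul_mem_lowerDegreeSpan (monomial_mem_degreeLT (Nat.lt_succ_self d.degree))
      ((b * a ^ d.degree) • X i)
    rw [hn, ← hd]
    convert! Submodule.add_mem _ h1 h2 using 1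
    ext x z
    simp only [hX, map_mul, eval_X, Pi.add_apply, Pi.smul_apply, smul_eq_mul, smul_eval]
    ring

/-- A single factor `a ^ n` serves all monomials: for degree below `n`, the discrepancy between `a ^
deg` and `a ^ n` multiplies a polynomial in `x` of degree below `n`. -/
lemma step_sub_mem (a b : ℝ) {n : ℕ} {p : MvPolynomial ι ℝ} (hp : p ∈ degreeLT ι (n + 1)) :
    (fun x z => eval (a • x + b • z) p - a ^ n * eval x p) ∈ lowerDegreeSpan ι n := by
  rw [degreeLT, restrictSupport_eq_span] at hp
  induction hp using Submodule.span_induction with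
  | mem p hp =>
    obtain ⟨d, hd, rfl⟩ := hp
    have hd' : d.degree < n + 1 := hd
    rcases Nat.lt_succ_iff_lt_or_eq.1 hd' with h | h
    · have h1 := lowerDegreeSpan_mono h.le (monomial_step_sub_mem a b d)
      have h2 := mul_mem_lowerDegreeSpan (monomial_mem_degreeLT h) (C (a ^ d.degree - a ^ n))
      convert! Submodule.add_mem _ h1 h2 using 1
      ext x z
      simp only [Pi.add_apply, eval_C]
      ring
    · rw [← h]
      exact monomial_step_sub_mem a b d
  | zero => simp only [map_zero, mul_zero, sub_zero]; exact Submodule.zero_mem _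
  | add p q _ _ h1 h2 =>
    convert! Submodule.add_mem _ h1 h2 using 1
    ext x z
    simp
    ring
  | smul r p _ h1 =>
    convert! Submodule.smul_mem _ r h1 using 1
    ext x z
    simp
    ring

end PolynomialAlgebra

/-! ### Noise stability of polynomials in Gaussian `L²`. -/

section PolynomialAnalysis

open MvPolynomial

variable {ι : Type*} [Fintype ι]

instance (n : ℕ) : FiniteDimensional ℝ (degreeLT ι n) := by
  have : Finite {d : ι →₀ ℕ | d.degree < n} := by
    have h := Finsupp.finite_of_degree_le (σ := ι) n
    exact h.subset fun d (hd : d.degree < n) => hd.le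
  exact Module.Finite.of_basis (basisRestrictSupport ℝ {d : ι →₀ ℕ | d.degree < n})

lemma integrable_eval_gaussianPi (p : MvPolynomial ι ℝ) :
    Integrable (fun x => eval x p) (gaussianPi ι) := by
  simp_rw [eval_eq']
  refine integrable_finsetSum _ fun d _ => Integrable.const_mul ?_ _
  refine Integrable.fintype_prod (f := fun i t => t ^ d i) fun i => ?_
  have h := memLp_id_gaussianReal (μ := 0) (v := 1) (d i : NNReal)
  refine (integrable_norm_iff (by fun_prop)).1 ?_
  have h2 := MemLp.integrable_norm_pow' (f := id) (p := d i) (by simpa using h)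
  simpa only [norm_pow, id] using h2

lemma memLp_eval_gaussianPi (p : MvPolynomial ι ℝ) :
    MemLp (fun x => eval x p) 2 (gaussianPi ι) := by
  refine (memLp_two_iff_integrable_sq (integrable_eval_gaussianPi p).1).2 ?_
  have h := integrable_eval_gaussianPi (p ^ 2)
  simp only [map_pow] at h
  exact h

/-- The class of a polynomial in `L²` of the Gaussian measure. -/
noncomputable def polynomialToLp : MvPolynomial ι ℝ →ₗ[ℝ] Lp ℝ 2 (gaussianPi ι) where
  toFun p := (memLp_eval_gaussianPi p).toLp
  map_add' p q := by
    rw [← MemLp.toLp_add]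
    congr 1
    ext x; simp
  map_smul' c p := by
    rw [RingHom.id_apply, ← MemLp.toLp_const_smul]
    congr 1
    ext x; simp

lemma inner_polynomialToLp (p q : MvPolynomial ι ℝ) :
    inner ℝ (polynomialToLp p) (polynomialToLp q) = ∫ x, eval x p * eval x q ∂(gaussianPi ι) := by
  rw [L2.inner_def]
  refine integral_congr_ae ?_
  filter_upwards [(memLp_eval_gaussianPi p).coeFn_toLp, (memLp_eval_gaussianPi q).coeFn_toLp]
    with x h1 h2
  change inner ℝ ((memLp_eval_gaussianPi p).toLp _ x) ((memLp_eval_gaussianPi q).toLp _ x) = _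
  rw [h1, h2]
  simp [mul_comm]

/-- Projection onto a finite-dimensional space. The remainder `p - g` plays the role of the top
component of a Hermite expansion, so no explicit Hermite basis is needed. -/
lemma exists_orthogonal_decomposition (n : ℕ) (p : MvPolynomial ι ℝ) :
    ∃ g ∈ degreeLT ι n, ∀ q ∈ degreeLT ι n,
      ∫ x, eval x (p - g) * eval x q ∂(gaussianPi ι) = 0 := by
  obtain ⟨w, ⟨g, hg, rfl⟩, hw⟩ := Submodule.HasOrthogonalProjection.exists_orthogonal
    (K := (degreeLT ι n).map polynomialToLp) (polynomialToLp p)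
  refine ⟨g, hg, fun q hq => ?_⟩
  rw [← inner_polynomialToLp, map_sub]
  exact Submodule.inner_left_of_mem_orthogonal (Submodule.mem_map_of_mem hq) hw

lemma integral_mul_lowerDegreeSpan {n : ℕ} {h : MvPolynomial ι ℝ}
    (hh : ∀ q ∈ degreeLT ι n, ∫ x, eval x h * eval x q ∂(gaussianPi ι) = 0)
    {F : (ι → ℝ) → (ι → ℝ) → ℝ} (hF : F ∈ lowerDegreeSpan ι n) :
    Integrable (fun p : (ι → ℝ) × (ι → ℝ) => eval p.1 h * F p.1 p.2)
      ((gaussianPi ι).prod (gaussianPi ι)) ∧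
    ∫ p, eval p.1 h * F p.1 p.2 ∂((gaussianPi ι).prod (gaussianPi ι)) = 0 := by
  induction hF using Submodule.span_induction with
  | mem F hF =>
    obtain ⟨c, hc, e, rfl⟩ := hF
    have h1 := (integrable_eval_gaussianPi (h * c)).mul_prod (integrable_eval_gaussianPi e)
    have h2 := integral_prod_mul (μ := gaussianPi ι) (ν := gaussianPi ι)
      (fun x => eval x (h * c)) (fun x => eval x e)
    simp only [map_mul, mul_assoc] at h1 h2
    refine ⟨h1, ?_⟩
    rw [h2, hh c hc, zero_mul]
  | zero => simp
  | add F G _ _ h1 h2 =>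
    simp only [Pi.add_apply, mul_add]
    refine ⟨h1.1.add h2.1, ?_⟩
    rw [integral_add h1.1 h2.1, h1.2, h2.2, add_zero]
  | smul r F _ h1 =>
    simp only [Pi.smul_apply, smul_eq_mul, mul_left_comm _ r]
    refine ⟨h1.1.const_mul r, ?_⟩
    rw [integral_const_mul, h1.2, mul_zero]

/-- The noise form `E[p(X) q(aX + bZ)]`. -/
noncomputable def noiseForm (a b : ℝ) (p q : MvPolynomial ι ℝ) : ℝ :=
  ∫ w, eval w.1 p * eval (a • w.1 + b • w.2) q ∂((gaussianPi ι).prod (gaussianPi ι))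

variable {a b : ℝ}

lemma measurePreserving_step (h : a ^ 2 + b ^ 2 = 1) :
    MeasurePreserving (fun p : (ι → ℝ) × (ι → ℝ) => a • p.1 + b • p.2)
      ((gaussianPi ι).prod (gaussianPi ι)) (gaussianPi ι) :=
  measurePreserving_fst.comp (measurePreserving_rotate h)

lemma memLp_eval_fst (p : MvPolynomial ι ℝ) :
    MemLp (fun w : (ι → ℝ) × (ι → ℝ) => eval w.1 p) 2 ((gaussianPi ι).prod (gaussianPi ι)) :=
  (memLp_eval_gaussianPi p).comp_measurePreserving measurePreserving_fst

lemma memLp_eval_step (h : a ^ 2 + b ^ 2 = 1) (p : MvPolynomial ι ℝ) :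
    MemLp (fun w : (ι → ℝ) × (ι → ℝ) => eval (a • w.1 + b • w.2) p) 2
      ((gaussianPi ι).prod (gaussianPi ι)) :=
  (memLp_eval_gaussianPi p).comp_measurePreserving (measurePreserving_step h)

lemma integrable_noiseForm (h : a ^ 2 + b ^ 2 = 1) (p q : MvPolynomial ι ℝ) :
    Integrable (fun w : (ι → ℝ) × (ι → ℝ) => eval w.1 p * eval (a • w.1 + b • w.2) q)
      ((gaussianPi ι).prod (gaussianPi ι)) :=
  (memLp_eval_fst p).integrable_mul (memLp_eval_step h q)

lemma noiseForm_add_left (h : a ^ 2 + b ^ 2 = 1) (p p' q : MvPolynomial ι ℝ) :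
    noiseForm a b (p + p') q = noiseForm a b p q + noiseForm a b p' q := by
  rw [noiseForm, noiseForm, noiseForm,
    ← integral_add (integrable_noiseForm h p q) (integrable_noiseForm h p' q)]
  refine integral_congr_ae (ae_of_all _ fun w => ?_)
  simp [add_mul]

lemma noiseForm_comm (h : a ^ 2 + b ^ 2 = 1) (p q : MvPolynomial ι ℝ) :
    noiseForm a b p q = noiseForm a b q p := by
  have hm := measurePreserving_rotate (ι := ι) h
  rw [noiseForm, noiseForm]
  conv_rhs => rw [← hm.map_eq]
  rw [integral_map hm.measurable.aemeasurable
    (by rw [hm.map_eq]; exact (integrable_noiseForm h q p).1)]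
  refine integral_congr_ae (ae_of_all _ fun w => ?_)
  have : a • (a • w.1 + b • w.2) + b • (b • w.1 - a • w.2) = w.1 := by
    ext i
    simp
    linear_combination (w.1 i) * h
  simp only [this]
  ring

lemma noiseForm_add_right (h : a ^ 2 + b ^ 2 = 1) (p q q' : MvPolynomial ι ℝ) :
    noiseForm a b p (q + q') = noiseForm a b p q + noiseForm a b p q' := by
  rw [noiseForm_comm h, noiseForm_add_left h, noiseForm_comm h q, noiseForm_comm h q']

lemma integral_fst_gaussianPi (p q : MvPolynomial ι ℝ) :
    ∫ w, eval w.1 p * eval w.1 q ∂((gaussianPi ι).prod (gaussianPi ι)) =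
      ∫ x, eval x p * eval x q ∂(gaussianPi ι) := by
  have := integral_prod_mul (μ := gaussianPi ι) (ν := gaussianPi ι)
    (fun x => eval x p * eval x q) (fun _ => 1)
  simpa using this

/-- Up to products `c(X) e(Z)` with `deg c < n`, `p (a X + b Z)` is `a ^ n p(X)`. By independence of
`X` and `Z`, pairing such products with `f(X)` gives zero. -/
lemma noiseForm_of_orthogonal (h : a ^ 2 + b ^ 2 = 1) {n : ℕ} {f p : MvPolynomial ι ℝ}
    (hf : ∀ q ∈ degreeLT ι n, ∫ x, eval x f * eval x q ∂(gaussianPi ι) = 0)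
    (hp : p ∈ degreeLT ι (n + 1)) :
    noiseForm a b f p = a ^ n * ∫ x, eval x f * eval x p ∂(gaussianPi ι) := by
  have h1 := integral_mul_lowerDegreeSpan hf (step_sub_mem a b hp)
  rw [← integral_fst_gaussianPi, ← integral_const_mul, noiseForm, ← sub_eq_zero, ← integral_sub,
    ← h1.2]
  · refine integral_congr_ae (ae_of_all _ fun w => ?_)
    simp only
    ring
  · exact integrable_noiseForm h f p
  · exact ((memLp_eval_fst f).integrable_mul (memLp_eval_fst p)).const_mul _

/-- Peel off the top component `f`, which is damped by exactly `a ^ n`. The cross terms with the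
lower part `g` vanish, and induction handles `g`. -/
lemma pow_mul_integral_sq_le_noiseForm (h : a ^ 2 + b ^ 2 = 1) (ha : 0 ≤ a) {n : ℕ}
    {p : MvPolynomial ι ℝ} (hp : p ∈ degreeLT ι n) :
    a ^ n * ∫ x, eval x p * eval x p ∂(gaussianPi ι) ≤ noiseForm a b p p := by
  have ha1 : a ≤ 1 := by nlinarith [sq_nonneg b]
  induction n generalizing p with
  | zero =>
    have : p = 0 := by
      have : (p.support : Set (ι →₀ ℕ)) ⊆ {d | d.degree < 0} := (mem_restrictSupport_iff ℝ).1 hp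
      simpa using this
    simp [this, noiseForm]
  | succ n ih =>
    obtain ⟨g, hg, horth⟩ := exists_orthogonal_decomposition n p
    set f := p - g with hf
    have hpf : p = f + g := by rw [hf]; ring
    have hg' := degreeLT_mono (Nat.le_succ n) hg
    have hfm : f ∈ degreeLT ι (n + 1) := Submodule.sub_mem _ hp hg'
    have e1 := noiseForm_of_orthogonal h horth hfm
    have e2 := noiseForm_of_orthogonal h horth hg'
    have e3 := ih hg
    rw [horth g hg, mul_zero] at e2
    have e4 : ∫ x, eval x p * eval x p ∂(gaussianPi ι) =
        ∫ x, eval x f * eval x f ∂(gaussianPi ι) + ∫ x, eval x g * eval x g ∂(gaussianPi ι) := by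
      have hi : ∀ q : MvPolynomial ι ℝ, Integrable (fun x => eval x q * eval x q) (gaussianPi ι) :=
        fun q => (memLp_eval_gaussianPi q).integrable_mul (memLp_eval_gaussianPi q)
      rw [← integral_add (hi f) (hi g), ← sub_eq_zero,
        ← integral_sub (hi p) (by exact (hi f).add (hi g))]
      have : ∫ x, 2 * (eval x f * eval x g) ∂(gaussianPi ι) = 0 := by
        rw [integral_const_mul, horth g hg, mul_zero]
      rw [← this]
      refine integral_congr_ae (ae_of_all _ fun x => ?_)
      rw [hpf]
      simp only [map_add]
      ring
    have e5 : 0 ≤ ∫ x, eval x p * eval x p ∂(gaussianPi ι) :=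
      integral_nonneg fun x => mul_self_nonneg _
    have e6 : noiseForm a b p p = noiseForm a b f f + noiseForm a b g g := by
      conv_lhs => rw [hpf]
      rw [noiseForm_add_left h, noiseForm_add_right h, noiseForm_add_right h, e2,
        noiseForm_comm h g f, e2]
      ring
    calc a ^ (n + 1) * ∫ x, eval x p * eval x p ∂(gaussianPi ι)
        ≤ a ^ n * ∫ x, eval x p * eval x p ∂(gaussianPi ι) :=
          mul_le_mul_of_nonneg_right (pow_le_pow_of_le_one ha ha1 (Nat.le_succ n)) e5
      _ ≤ _ := by rw [e6, e4, e1, mul_add]; gcongr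

/-- Noise stability of low degree polynomials. -/
lemma integral_sq_step_sub_le (h : a ^ 2 + b ^ 2 = 1) (ha : 0 ≤ a) {D : ℕ}
    {p : MvPolynomial ι ℝ} (hp : p.totalDegree ≤ D) :
    ∫ w, (eval w.1 p - eval (a • w.1 + b • w.2) p) ^ 2 ∂((gaussianPi ι).prod (gaussianPi ι)) ≤
      2 * ((D + 1) * (1 - a)) * ∫ x, eval x p ^ 2 ∂(gaussianPi ι) := by
  have h1 := pow_mul_integral_sq_le_noiseForm h ha (mem_degreeLT_of_totalDegree_le hp)
  simp only [← sq] at h1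
  have h2 : ∫ w, eval w.1 p ^ 2 ∂((gaussianPi ι).prod (gaussianPi ι)) =
      ∫ x, eval x p ^ 2 ∂(gaussianPi ι) := by
    simpa [sq] using integral_fst_gaussianPi p p
  have hms := measurePreserving_step (ι := ι) h
  have h3 : ∫ w, eval (a • w.1 + b • w.2) p ^ 2 ∂((gaussianPi ι).prod (gaussianPi ι)) =
      ∫ x, eval x p ^ 2 ∂(gaussianPi ι) := by
    conv_rhs => rw [← hms.map_eq]
    rw [integral_map hms.measurable.aemeasurable]
    rw [hms.map_eq]
    exact (memLp_eval_gaussianPi p).integrable_sq.1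
  have h4 : ∫ w, (eval w.1 p - eval (a • w.1 + b • w.2) p) ^ 2
      ∂((gaussianPi ι).prod (gaussianPi ι)) =
      ∫ w, eval w.1 p ^ 2 ∂((gaussianPi ι).prod (gaussianPi ι)) +
      ∫ w, eval (a • w.1 + b • w.2) p ^ 2 ∂((gaussianPi ι).prod (gaussianPi ι)) -
      2 * noiseForm a b p p := by
    rw [noiseForm, ← integral_const_mul, ← integral_add, ← integral_sub]
    · refine integral_congr_ae (ae_of_all _ fun w => ?_)
      ring
    · exact (memLp_eval_fst p).integrable_sq.add (memLp_eval_step h p).integrable_sq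
    · exact (integrable_noiseForm h p p).const_mul _
    · exact (memLp_eval_fst p).integrable_sq
    · exact (memLp_eval_step h p).integrable_sq
  -- Bernoulli's inequality. The exponent is `D + 1` because degree at most `D` is recorded as
  -- degree less than `D + 1`.
  have h5 : 1 - (D + 1 : ℝ) * (1 - a) ≤ a ^ (D + 1) := by
    have := one_add_mul_le_pow (a := a - 1) (by linarith) (D + 1)
    push_cast at this
    rw [add_sub_cancel] at this
    linarith
  have h6 : 0 ≤ ∫ x, eval x p ^ 2 ∂(gaussianPi ι) := integral_nonneg fun x => sq_nonneg _
  rw [h4, h2, h3]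
  nlinarith [mul_le_mul_of_nonneg_right h5 h6]

end PolynomialAnalysis

/-! ### Stability of randomized rounding. -/

section Rounding

instance : IsProbabilityMeasure ((volume : Measure ℝ)[|Set.Icc (-1 : ℝ) 1]) :=
  cond_isProbabilityMeasure_of_finite (by simp) (by simp)

instance (N : ℕ) : IsProbabilityMeasure (roundingLaw N) := by
  unfold roundingLaw; infer_instance

instance (M N : ℕ) : IsProbabilityMeasure (disorderLaw M N) := by
  unfold disorderLaw; infer_instance

lemma round_mem_cube {N : ℕ} (U : Fin N → ℝ) (x : EuclideanSpace ℝ (Fin N)) :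
    round U x ∈ cube N := by
  intro j
  unfold round
  split_ifs
  · exact Or.inl rfl
  · exact Or.inr rfl

/-- With a shared threshold the two signs differ, at squared cost `4`, only when it falls between
`x` and `y`, which has probability at most `|x - y| / 2`. -/
lemma lintegral_sq_threshold_sub_le (x y : ℝ) :
    ∫⁻ t, ENNReal.ofReal (((if t ≤ x then (1 : ℝ) else -1) - (if t ≤ y then 1 else -1)) ^ 2)
      ∂((volume : Measure ℝ)[|Set.Icc (-1 : ℝ) 1]) ≤ ENNReal.ofReal (2 * |x - y|) := by
  have h1 : ∀ t, ENNReal.ofReal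
      (((if t ≤ x then (1 : ℝ) else -1) - (if t ≤ y then 1 else -1)) ^ 2) =
      (Set.uIoc x y).indicator (fun _ => ENNReal.ofReal 4) t := by
    intro t
    by_cases h1 : t ≤ x <;> by_cases h2 : t ≤ y
    · have : t ∉ Set.uIoc x y := by
        simp only [Set.mem_uIoc, not_or, not_and, not_le]
        exact ⟨fun h => absurd h1 (not_le.2 h), fun h => absurd h2 (not_le.2 h)⟩
      simp [h1, h2, this]
    · have : t ∈ Set.uIoc x y := Set.mem_uIoc.2 (Or.inr ⟨not_le.1 h2, h1⟩)
      simp only [h1, h2, this, Set.indicator_of_mem, if_true, if_false]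
      norm_num
    · have : t ∈ Set.uIoc x y := Set.mem_uIoc.2 (Or.inl ⟨not_le.1 h1, h2⟩)
      simp only [h1, h2, this, Set.indicator_of_mem, if_true, if_false]
      norm_num
    · have : t ∉ Set.uIoc x y := by
        simp only [Set.mem_uIoc, not_or, not_and]
        exact ⟨fun _ h => h2 h, fun _ h => h1 h⟩
      simp [h1, h2, this]
  simp_rw [h1]
  rw [lintegral_indicator measurableSet_uIoc, lintegral_const, Measure.restrict_apply_univ,
    cond_apply measurableSet_Icc]
  have h2 : (volume : Measure ℝ) (Set.Icc (-1) 1 ∩ Set.uIoc x y) ≤ ENNReal.ofReal |x - y| := by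
    refine (measure_mono Set.inter_subset_right).trans ?_
    rw [Set.uIoc, Real.volume_Ioc, max_sub_min_eq_abs']
  calc _ ≤ ENNReal.ofReal 4 * ((volume (Set.Icc (-1 : ℝ) 1))⁻¹ * ENNReal.ofReal |x - y|) := by
        gcongr
    _ = _ := by
        rw [Real.volume_Icc, ← ENNReal.ofReal_inv_of_pos (by norm_num),
          ← ENNReal.ofReal_mul (by norm_num), ← ENNReal.ofReal_mul (by norm_num)]
        congr 1
        ring

/-- The expected cost is linear in `|x j - y j|`; the inequality `2 |u| ≤ l + u ^ 2 / l` trades it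
for the squared distance that noise stability controls. -/
lemma lintegral_sq_round_sub_le {N : ℕ} (x y : EuclideanSpace ℝ (Fin N)) {l : ℝ} (hl : 0 < l) :
    ∫⁻ U, ENNReal.ofReal (∑ j, (round U x j - round U y j) ^ 2) ∂(roundingLaw N) ≤
      ENNReal.ofReal (l * N) + ENNReal.ofReal l⁻¹ * ENNReal.ofReal (‖x - y‖ ^ 2) := by
  let f : Fin N → ℝ → ENNReal := fun j t =>
    ENNReal.ofReal (((if t ≤ x j then (1 : ℝ) else -1) - (if t ≤ y j then 1 else -1)) ^ 2)
  have hmeas : ∀ j : Fin N, Measurable (f j) := by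
    intro j
    refine (((Measurable.ite measurableSet_Iic measurable_const measurable_const).sub
      (Measurable.ite measurableSet_Iic measurable_const measurable_const)).pow_const 2).ennreal_ofReal
  have h1 : ∀ U : Fin N → ℝ, ENNReal.ofReal (∑ j, (round U x j - round U y j) ^ 2) =
      ∑ j, f j (U j) := by
    intro U
    rw [ENNReal.ofReal_sum_of_nonneg fun j _ => sq_nonneg _]
    rfl
  have h2 : ∀ j : Fin N, Measurable fun U : Fin N → ℝ => f j (U j) := fun j =>
    (hmeas j).comp (measurable_pi_apply j)
  rw [lintegral_congr h1, lintegral_finsetSum _ fun j _ => h2 j]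
  calc _ ≤ ∑ j : Fin N, ENNReal.ofReal (2 * |x j - y j|) := by
        refine Finset.sum_le_sum fun j _ => ?_
        rw [roundingLaw, (measurePreserving_eval _ j).lintegral_comp (hmeas j)]
        exact lintegral_sq_threshold_sub_le _ _
    _ = ENNReal.ofReal (∑ j : Fin N, 2 * |x j - y j|) :=
        (ENNReal.ofReal_sum_of_nonneg fun j _ => by positivity).symm
    _ ≤ ENNReal.ofReal (l * N + l⁻¹ * ‖x - y‖ ^ 2) := by
        refine ENNReal.ofReal_le_ofReal ?_
        rw [EuclideanSpace.real_norm_sq_eq, Finset.mul_sum, mul_comm l]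
        have : (N : ℝ) * l = ∑ _j : Fin N, l := by simp
        rw [this, ← Finset.sum_add_distrib]
        refine Finset.sum_le_sum fun j _ => ?_
        have h2 := sq_nonneg (|x j - y j| - l)
        have h3 : l⁻¹ * (|x j - y j| - l) ^ 2 = l + l⁻¹ * (x - y) j ^ 2 - 2 * |x j - y j| := by
          rw [PiLp.sub_apply, ← sq_abs (x j - y j)]
          field_simp
          ring
        have h4 : 0 ≤ l⁻¹ * (|x j - y j| - l) ^ 2 := by positivity
        linarith
    _ = _ := by
        rw [ENNReal.ofReal_add (by positivity) (by positivity),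
          ENNReal.ofReal_mul (inv_nonneg.2 hl.le)]

end Rounding

/-! ### One stable transition for a fixed seed. -/

section Seed

variable {M N : ℕ} {Ω : Type*} {a b : ℝ}

lemma lintegral_norm_sq_step_sub_le (h : a ^ 2 + b ^ 2 = 1) (ha : 0 ≤ a) {D : ℕ}
    {A : Disorder M N → Ω → EuclideanSpace ℝ (Fin N)} (hA : IsPolynomialOfDegree D A) (ω : Ω) :
    ∫⁻ w, ENNReal.ofReal (‖A w.1 ω - A (a • w.1 + b • w.2) ω‖ ^ 2)
      ∂((disorderLaw M N).prod (disorderLaw M N)) ≤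
      ENNReal.ofReal (2 * ((D + 1) * (1 - a))) *
        ∫⁻ x, ENNReal.ofReal (‖A x ω‖ ^ 2) ∂(disorderLaw M N) := by
  have hdis : disorderLaw M N = gaussianPi (Fin M × Fin N) := rfl
  have ha1 : a ≤ 1 := by nlinarith [sq_nonneg b]
  choose P hdeg hP using fun j => hA ω j
  rw [hdis]
  simp only [EuclideanSpace.real_norm_sq_eq, PiLp.sub_apply, hP]
  simp_rw [ENNReal.ofReal_sum_of_nonneg fun j _ => sq_nonneg _]
  have i1 : ∀ j, Integrable (fun w : Disorder M N × Disorder M N =>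
      (MvPolynomial.eval w.1 (P j) - MvPolynomial.eval (a • w.1 + b • w.2) (P j)) ^ 2)
      ((gaussianPi (Fin M × Fin N)).prod (gaussianPi (Fin M × Fin N))) := fun j =>
    ((memLp_eval_fst (P j)).sub (memLp_eval_step h (P j))).integrable_sq
  have i2 : ∀ j, Integrable (fun x : Disorder M N => MvPolynomial.eval x (P j) ^ 2)
      (gaussianPi (Fin M × Fin N)) := fun j => (memLp_eval_gaussianPi (P j)).integrable_sq
  rw [lintegral_finsetSum' _ fun j _ => (i1 j).1.aemeasurable.ennreal_ofReal,
    lintegral_finsetSum' _ fun j _ => (i2 j).1.aemeasurable.ennreal_ofReal, Finset.mul_sum]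
  refine Finset.sum_le_sum fun j _ => ?_
  rw [← ofReal_integral_eq_lintegral_ofReal (i1 j) (ae_of_all _ fun _ => sq_nonneg _),
    ← ofReal_integral_eq_lintegral_ofReal (i2 j) (ae_of_all _ fun _ => sq_nonneg _),
    ← ENNReal.ofReal_mul (mul_nonneg zero_le_two (mul_nonneg (by positivity) (by linarith)))]
  exact ENNReal.ofReal_le_ofReal (integral_sq_step_sub_le h ha (hdeg j))

/-- Pairs of disorders for which `F` finds solutions at squared distance at most `θ`. -/
def stablePairs (F : Disorder M N → Fin N → ℝ) (I : Set ℝ) (θ : ℝ) :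
    Set (Disorder M N × Disorder M N) :=
  {p | F p.1 ∈ solutions p.1 I ∧ F p.2 ∈ solutions p.2 I ∧ ∑ j, (F p.1 j - F p.2 j) ^ 2 ≤ θ}

lemma measurableSet_mem_solutions {I : Set ℝ} (hI : MeasurableSet I) {α : Type*}
    [MeasurableSpace α] {g : α → Disorder M N} {f : α → Fin N → ℝ} (hg : Measurable g)
    (hf : Measurable f) : MeasurableSet {x | f x ∈ solutions (g x) I} := by
  have : {x | f x ∈ solutions (g x) I} = (⋂ j, (({x | f x j = 1} ∪ {x | f x j = -1}))) ∩
      ⋂ i : Fin M, (fun x => (∑ j, g x (i, j) * f x j) / √(N : ℝ)) ⁻¹' I := by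
    ext x
    simp [solutions, cube]
  rw [this]
  refine (MeasurableSet.iInter fun j => ?_).inter (MeasurableSet.iInter fun i => ?_)
  · exact ((measurable_pi_apply j).comp hf (measurableSet_singleton 1)).union
      ((measurable_pi_apply j).comp hf (measurableSet_singleton (-1)))
  · refine Measurable.div_const (Finset.measurable_sum _ fun j _ => ?_) _ hI
    exact ((measurable_pi_apply _).comp hg).mul ((measurable_pi_apply j).comp hf)

lemma measurableSet_stablePairs {F : Disorder M N → Fin N → ℝ} (hF : Measurable F) {I : Set ℝ}
    (hI : MeasurableSet I) (θ : ℝ) : MeasurableSet (stablePairs F I θ) := by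
  refine (measurableSet_mem_solutions hI measurable_fst (hF.comp measurable_fst)).inter
    ((measurableSet_mem_solutions hI measurable_snd (hF.comp measurable_snd)).inter ?_)
  have hm : Measurable fun p : Disorder M N × Disorder M N =>
      ∑ j, (F p.1 j - F p.2 j) ^ 2 :=
    Finset.measurable_sum _ fun j _ => (((measurable_pi_apply j).comp
      (hF.comp measurable_fst)).sub ((measurable_pi_apply j).comp
      (hF.comp measurable_snd))).pow_const 2
  exact hm measurableSet_Iic

lemma stablePairs_symm {F : Disorder M N → Fin N → ℝ} {I : Set ℝ} {θ : ℝ} (x y : Disorder M N)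
    (h : (x, y) ∈ stablePairs F I θ) : (y, x) ∈ stablePairs F I θ := by
  obtain ⟨h1, h2, h3⟩ := h
  refine ⟨h2, h1, ?_⟩
  simp only at h3 ⊢
  simpa only [sub_sq_comm] using h3

lemma sq_measure_le_lintegral_transfer_add {ι : Type*} [Fintype ι] (ha : 0 ≤ a) (hb : 0 < b)
    (h : a ^ 2 + b ^ 2 = 1) {E : Set (ι → ℝ)} (hE : MeasurableSet E)
    {R : Set ((ι → ℝ) × (ι → ℝ))} (hR : MeasurableSet R) {g : (ι → ℝ) × (ι → ℝ) → ENNReal}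
    (hg : Measurable g)
    (hgR : ∀ x z, x ∈ E → a • x + b • z ∈ E → (x, a • x + b • z) ∉ R → 1 ≤ g (x, z)) :
    gaussianPi ι E ^ 2 ≤ ∫⁻ x, transfer a b R 1 x ∂(gaussianPi ι) +
      ∫⁻ w, g w ∂((gaussianPi ι).prod (gaussianPi ι)) := by
  refine (sq_measure_le_lintegral_transfer ha hb h hE).trans ?_
  rw [lintegral_prod _ hg.aemeasurable,
    ← lintegral_add_left (measurable_transfer hR measurable_one)]
  refine lintegral_mono fun x => ?_
  have hgx : Measurable fun z => g (x, z) := hg.comp measurable_prodMk_left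
  simp only [transfer]
  rw [← lintegral_add_right _ hgx]
  refine lintegral_mono fun z => ?_
  simp only [Pi.one_apply, mul_one]
  by_cases hx : (x, a • x + b • z) ∈ E ×ˢ E
  · rw [Set.indicator_of_mem hx]
    by_cases hxR : (x, a • x + b • z) ∈ R
    · rw [Set.indicator_of_mem hxR]
      exact le_self_add
    · exact le_add_left (hgR x z hx.1 hx.2 hxR)
  · rw [Set.indicator_of_notMem hx]
    exact zero_le

/-- Positive correlation gives a pair of solved instances. The pairs whose outputs are further apart
than `θ` are discarded by Markov's inequality. -/
lemma sq_measure_solved_le (ha : 0 ≤ a) (hb : 0 < b) (h : a ^ 2 + b ^ 2 = 1)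
    {F : Disorder M N → Fin N → ℝ} (hF : Measurable F) {I : Set ℝ} (hI : MeasurableSet I) {θ : ℝ}
    (hθ : 0 < θ) :
    disorderLaw M N {G | F G ∈ solutions G I} ^ 2 ≤
      ∫⁻ x, transfer a b (stablePairs F I θ) 1 x ∂(disorderLaw M N) +
      ENNReal.ofReal θ⁻¹ * ∫⁻ w, ENNReal.ofReal (∑ j, (F w.1 j - F (a • w.1 + b • w.2) j) ^ 2)
        ∂((disorderLaw M N).prod (disorderLaw M N)) := by
  have hE : MeasurableSet {G | F G ∈ solutions G I} := measurableSet_mem_solutions hI measurable_id hF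
  have hm : Measurable fun w : Disorder M N × Disorder M N =>
      ENNReal.ofReal (∑ j, (F w.1 j - F (a • w.1 + b • w.2) j) ^ 2) := by
    have h1 : Measurable fun w : Disorder M N × Disorder M N => F (a • w.1 + b • w.2) :=
      hF.comp (by fun_prop)
    exact (Finset.measurable_sum _ fun j _ => (((measurable_pi_apply j).comp
      (hF.comp measurable_fst)).sub ((measurable_pi_apply j).comp h1)).pow_const 2).ennreal_ofReal
  rw [← lintegral_const_mul _ hm]
  refine sq_measure_le_lintegral_transfer_add ha hb h hE (measurableSet_stablePairs hF hI θ)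
    (hm.const_mul _) fun x z hx hz hR => ?_
  have hθ' : ¬ ∑ j, (F x j - F (a • x + b • z) j) ^ 2 ≤ θ := fun h => hR ⟨hx, hz, h⟩
  simp only
  rw [← ENNReal.ofReal_mul (inv_nonneg.2 hθ.le), ENNReal.one_le_ofReal, inv_mul_eq_div,
    one_le_div hθ]
  exact (not_le.1 hθ').le

end Seed

/-! ### Choosing the auxiliary randomness. -/

section SeedSelection

variable {M N : ℕ} {Ω : Type*} {a b : ℝ}

lemma transfer_one_le_one {ι : Type*} [Fintype ι] (R : Set ((ι → ℝ) × (ι → ℝ))) (x : ι → ℝ) :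
    transfer a b R 1 x ≤ 1 := by
  rw [transfer]
  calc _ ≤ ∫⁻ _, 1 ∂(gaussianPi ι) := by
        refine lintegral_mono fun z => ?_
        simp only [Pi.one_apply, mul_one]
        exact Set.indicator_le_self _ _ _
    _ = 1 := by simp

variable [MeasurableSpace Ω]

lemma measurable_round_comp {α : Type*} [MeasurableSpace α] {U : α → Fin N → ℝ}
    {x : α → EuclideanSpace ℝ (Fin N)} (hU : Measurable U) (hx : Measurable x) :
    Measurable fun t => round (U t) (x t) := by
  refine measurable_pi_lambda _ fun j => ?_
  have hxj : Measurable fun t => x t j := (EuclideanSpace.proj (𝕜 := ℝ) j).continuous.measurable.comp hx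
  have hUj : Measurable fun t => U t j := (measurable_pi_apply j).comp hU
  exact Measurable.ite (measurableSet_le hUj hxj) measurable_const measurable_const

lemma measurable_round_algorithm {A : Disorder M N → Ω → EuclideanSpace ℝ (Fin N)}
    (hAm : Measurable (Function.uncurry A)) {α : Type*} [MeasurableSpace α]
    {g : α → Disorder M N} {ξ : α → Ω × (Fin N → ℝ)} (hg : Measurable g) (hξ : Measurable ξ) :
    Measurable fun t => round (ξ t).2 (A (g t) (ξ t).1) :=
  measurable_round_comp (measurable_snd.comp hξ) (hAm.comp (hg.prodMk (measurable_fst.comp hξ)))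

lemma successProbability_eq_lintegral (μ : Measure Ω) [IsProbabilityMeasure μ]
    {A : Disorder M N → Ω → EuclideanSpace ℝ (Fin N)} (hAm : Measurable (Function.uncurry A))
    {I : Set ℝ} (hI : MeasurableSet I) :
    ENNReal.ofReal (successProbability μ A I) =
      ∫⁻ ξ : Ω × (Fin N → ℝ), disorderLaw M N {G | round ξ.2 (A G ξ.1) ∈ solutions G I}
        ∂(μ.prod (roundingLaw N)) := by
  have hSm : MeasurableSet {p : Disorder M N × (Ω × (Fin N → ℝ)) |
      round p.2.2 (A p.1 p.2.1) ∈ solutions p.1 I} :=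
    measurableSet_mem_solutions hI measurable_fst
      (measurable_round_algorithm hAm measurable_fst measurable_snd)
  rw [successProbability, Measure.real, ENNReal.ofReal_toReal (measure_ne_top _ _)]
  have hpa := measurePreserving_prodAssoc (disorderLaw M N) μ (roundingLaw N)
  have h1 := Measure.prod_apply_symm (μ := disorderLaw M N) (ν := μ.prod (roundingLaw N)) hSm
  rw [← hpa.measure_preimage hSm.nullMeasurableSet] at h1
  exact h1

lemma measurable_sq_round_step_sub {A : Disorder M N → Ω → EuclideanSpace ℝ (Fin N)}
    (hAm : Measurable (Function.uncurry A)) (a b : ℝ) :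
    Measurable fun p : (Ω × (Fin N → ℝ)) × (Disorder M N × Disorder M N) =>
      ENNReal.ofReal (∑ j, (round p.1.2 (A p.2.1 p.1.1) j -
        round p.1.2 (A (a • p.2.1 + b • p.2.2) p.1.1) j) ^ 2) := by
  have h1 : Measurable fun p : (Ω × (Fin N → ℝ)) × (Disorder M N × Disorder M N) =>
      round p.1.2 (A p.2.1 p.1.1) :=
    measurable_round_algorithm hAm (measurable_fst.comp measurable_snd) measurable_fst
  have h2 : Measurable fun p : (Ω × (Fin N → ℝ)) × (Disorder M N × Disorder M N) =>
      round p.1.2 (A (a • p.2.1 + b • p.2.2) p.1.1) :=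
    measurable_round_algorithm hAm (by fun_prop) measurable_fst
  exact (Finset.measurable_sum _ fun j _ => (((measurable_pi_apply j).comp h1).sub
    ((measurable_pi_apply j).comp h2)).pow_const 2).ennreal_ofReal

/-- Fixes the order of averaging: first the thresholds, at fixed seed and disorder pair (rounding);
then the disorder pair, at fixed seed (noise stability, which needs a fixed polynomial); last the
seed, where only the averaged second moment is known. -/
lemma lintegral_lintegral_le_of_fiber_le {V W X : Type*} [MeasurableSpace V] [MeasurableSpace W]
    [MeasurableSpace X] (μ : Measure Ω) (ν : Measure V) (ρ : Measure W) (γ : Measure X)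
    [IsProbabilityMeasure μ] [IsProbabilityMeasure ν] [IsProbabilityMeasure ρ]
    [IsProbabilityMeasure γ] {d : (Ω × V) × W → ENNReal} (hd : Measurable d)
    {n : Ω × W → ENNReal} (hn : Measurable n) {m : X × Ω → ENNReal} (hm : Measurable m)
    {c₁ c₂ c₃ : ENNReal} (hdn : ∀ ω w, ∫⁻ U, d ((ω, U), w) ∂ν ≤ c₁ + c₂ * n (ω, w))
    (hnm : ∀ ω, ∫⁻ w, n (ω, w) ∂ρ ≤ c₃ * ∫⁻ x, m (x, ω) ∂γ) :
    ∫⁻ ξ, ∫⁻ w, d (ξ, w) ∂ρ ∂(μ.prod ν) ≤ c₁ + c₂ * (c₃ * ∫⁻ z, m z ∂(γ.prod μ)) := by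
  have hfib : ∀ ω, ∫⁻ U, ∫⁻ w, d ((ω, U), w) ∂ρ ∂ν ≤ c₁ + c₂ * (c₃ * ∫⁻ x, m (x, ω) ∂γ) := by
    intro ω
    have hω : Measurable fun w => n (ω, w) := hn.comp measurable_prodMk_left
    have hmk : Measurable fun p : V × W => d ((ω, p.1), p.2) := hd.comp (by fun_prop)
    rw [lintegral_lintegral_swap (f := fun U w => d ((ω, U), w)) hmk.aemeasurable]
    calc _ ≤ ∫⁻ w, (c₁ + c₂ * n (ω, w)) ∂ρ := lintegral_mono (hdn ω)
      _ = c₁ + c₂ * ∫⁻ w, n (ω, w) ∂ρ := by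
          rw [lintegral_add_left measurable_const, lintegral_const_mul _ hω]
          simp
      _ ≤ _ := by
          gcongr
          exact hnm ω
  have hm' : Measurable fun ω => ∫⁻ x, m (x, ω) ∂γ := hm.lintegral_prod_left'
  rw [lintegral_prod _ hd.lintegral_prod_right'.aemeasurable]
  refine (lintegral_mono hfib).trans (le_of_eq ?_)
  rw [lintegral_add_left measurable_const, lintegral_const_mul _ (hm'.const_mul _),
    lintegral_const_mul _ hm', lintegral_prod_symm _ hm.aemeasurable]
  simp

lemma lintegral_sq_round_step_sub_le (h : a ^ 2 + b ^ 2 = 1) (ha : 0 ≤ a) {D : ℕ}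
    (μ : Measure Ω) [IsProbabilityMeasure μ] {A : Disorder M N → Ω → EuclideanSpace ℝ (Fin N)}
    (hAm : Measurable (Function.uncurry A)) (hA : IsPolynomialOfDegree D A) {l : ℝ} (hl : 0 < l) :
    ∫⁻ ξ : Ω × (Fin N → ℝ), ∫⁻ w, ENNReal.ofReal (∑ j, (round ξ.2 (A w.1 ξ.1) j -
        round ξ.2 (A (a • w.1 + b • w.2) ξ.1) j) ^ 2)
        ∂((disorderLaw M N).prod (disorderLaw M N)) ∂(μ.prod (roundingLaw N)) ≤
      ENNReal.ofReal (l * N) + ENNReal.ofReal l⁻¹ *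
        (ENNReal.ofReal (2 * ((D + 1) * (1 - a))) * secondMoment μ A) := by
  have hAd : Measurable fun p : Ω × (Disorder M N × Disorder M N) =>
      ENNReal.ofReal (‖A p.2.1 p.1 - A (a • p.2.1 + b • p.2.2) p.1‖ ^ 2) := by
    have e1 : Measurable fun p : Ω × (Disorder M N × Disorder M N) => A p.2.1 p.1 :=
      hAm.comp ((measurable_fst.comp measurable_snd).prodMk measurable_fst)
    have e2 : Measurable fun p : Ω × (Disorder M N × Disorder M N) =>
        A (a • p.2.1 + b • p.2.2) p.1 := by
      have : Measurable fun p : Ω × (Disorder M N × Disorder M N) => a • p.2.1 + b • p.2.2 := by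
        fun_prop
      exact hAm.comp (this.prodMk measurable_fst)
    exact ((e1.sub e2).norm.pow_const 2).ennreal_ofReal
  have hAn : Measurable fun p : Disorder M N × Ω => ENNReal.ofReal (‖A p.1 p.2‖ ^ 2) :=
    (hAm.norm.pow_const 2).ennreal_ofReal
  have hdn : ∀ (ω : Ω) (w : Disorder M N × Disorder M N),
      ∫⁻ U, ENNReal.ofReal (∑ j, (round U (A w.1 ω) j - round U (A (a • w.1 + b • w.2) ω) j) ^ 2)
        ∂(roundingLaw N) ≤ ENNReal.ofReal (l * N) + ENNReal.ofReal l⁻¹ *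
          ENNReal.ofReal (‖A w.1 ω - A (a • w.1 + b • w.2) ω‖ ^ 2) :=
    fun ω w => lintegral_sq_round_sub_le _ _ hl
  have hnm := fun ω => lintegral_norm_sq_step_sub_le h ha hA ω
  exact lintegral_lintegral_le_of_fiber_le μ (roundingLaw N)
    ((disorderLaw M N).prod (disorderLaw M N)) (disorderLaw M N)
    (measurable_sq_round_step_sub hAm a b) hAd hAn hdn hnm

/-- For some value of the auxiliary randomness, the rounded algorithm finds stable pairs of
solutions with good probability. -/
lemma exists_stable_seed (ha : 0 ≤ a) (hb : 0 < b) (h : a ^ 2 + b ^ 2 = 1) {D : ℕ}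
    (μ : Measure Ω) [IsProbabilityMeasure μ] {A : Disorder M N → Ω → EuclideanSpace ℝ (Fin N)}
    (hAm : Measurable (Function.uncurry A)) (hA : IsPolynomialOfDegree D A)
    {I : Set ℝ} (hI : MeasurableSet I) {θ l : ℝ} (hθ : 0 < θ) (hl : 0 < l) :
    ∃ F : Disorder M N → Fin N → ℝ, Measurable F ∧ (∀ G, F G ∈ cube N) ∧
      ENNReal.ofReal (successProbability μ A I) ^ 2 ≤
        ∫⁻ x, transfer a b (stablePairs F I θ) 1 x ∂(disorderLaw M N) +
        ENNReal.ofReal θ⁻¹ * (ENNReal.ofReal (l * N) + ENNReal.ofReal l⁻¹ *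
          (ENNReal.ofReal (2 * ((D + 1) * (1 - a))) * secondMoment μ A)) := by
  have hFξ : ∀ ξ : Ω × (Fin N → ℝ), Measurable fun G => round ξ.2 (A G ξ.1) := fun ξ =>
    measurable_round_algorithm hAm measurable_id measurable_const
  have hsm : Measurable fun ξ : Ω × (Fin N → ℝ) =>
      disorderLaw M N {G | round ξ.2 (A G ξ.1) ∈ solutions G I} :=
    measurable_measure_prodMk_right (measurableSet_mem_solutions hI measurable_fst
      (measurable_round_algorithm hAm measurable_fst measurable_snd))
  have hvm := (measurable_sq_round_step_sub hAm a b).lintegral_prod_right'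
    (ν := (disorderLaw M N).prod (disorderLaw M N))
  have h2 := lintegral_sq_round_step_sub_le h ha μ hAm hA hl
  have h3 : (∫⁻ ξ : Ω × (Fin N → ℝ), disorderLaw M N {G | round ξ.2 (A G ξ.1) ∈ solutions G I}
      ∂(μ.prod (roundingLaw N))) ^ 2 ≤
      ∫⁻ ξ : Ω × (Fin N → ℝ), (∫⁻ x, transfer a b (stablePairs (fun G => round ξ.2 (A G ξ.1)) I θ) 1 x
        ∂(disorderLaw M N)) ∂(μ.prod (roundingLaw N)) +
      ENNReal.ofReal θ⁻¹ * ∫⁻ ξ : Ω × (Fin N → ℝ), ∫⁻ w, ENNReal.ofReal (∑ j,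
        (round ξ.2 (A w.1 ξ.1) j - round ξ.2 (A (a • w.1 + b • w.2) ξ.1) j) ^ 2)
        ∂((disorderLaw M N).prod (disorderLaw M N)) ∂(μ.prod (roundingLaw N)) := by
    rw [← lintegral_const_mul _ hvm, ← lintegral_add_right _ (hvm.const_mul _)]
    refine (sq_lintegral_le _ hsm).trans (lintegral_mono fun ξ => ?_)
    rw [← sq]
    exact sq_measure_solved_le ha hb h (hFξ ξ) hI hθ
  have h4 : ∀ ξ : Ω × (Fin N → ℝ), ∫⁻ x, transfer a b
      (stablePairs (fun G => round ξ.2 (A G ξ.1)) I θ) 1 x ∂(disorderLaw M N) ≤ 1 := fun ξ =>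
    (lintegral_mono fun x => transfer_one_le_one _ x).trans (by simp)
  -- The error term has already been averaged over seeds, so it suffices that one seed attains at
  -- least the average probability of a stable pair.
  obtain ⟨ξ, hξ⟩ := exists_lintegral_le (μ := μ.prod (roundingLaw N))
    (f := fun ξ : Ω × (Fin N → ℝ) => ∫⁻ x, transfer a b
      (stablePairs (fun G => round ξ.2 (A G ξ.1)) I θ) 1 x ∂(disorderLaw M N))
    (ne_top_of_le_ne_top ENNReal.one_ne_top ((lintegral_mono h4).trans (by simp)))
  refine ⟨fun G => round ξ.2 (A G ξ.1), hFξ ξ, fun G => round_mem_cube _ _, ?_⟩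
  rw [successProbability_eq_lintegral μ hAm hI]
  exact h3.trans (add_le_add hξ (mul_le_mul_right h2 _))

end SeedSelection

/-! ### Entropy of cube points near a point or a subspace. -/

section Counting

/-- The cube as a finite set. -/
noncomputable def cubeFinset (N : ℕ) : Finset (Fin N → ℝ) :=
  Fintype.piFinset fun _ => {1, -1}

lemma mem_cubeFinset {N : ℕ} {σ : Fin N → ℝ} : σ ∈ cubeFinset N ↔ σ ∈ cube N := by
  simp [cubeFinset, cube]

lemma card_cubeFinset (N : ℕ) : (cubeFinset N).card = 2 ^ N := by
  rw [cubeFinset, Fintype.card_piFinset]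
  have : ({1, -1} : Finset ℝ).card = 2 := Finset.card_pair (by norm_num)
  simp [this]

lemma norm_sq_of_mem_cube {N : ℕ} {σ : Fin N → ℝ} (hσ : σ ∈ cube N) :
    ‖(WithLp.toLp 2 σ : EuclideanSpace ℝ (Fin N))‖ ^ 2 = N := by
  rw [EuclideanSpace.real_norm_sq_eq]
  have : ∀ j, σ j ^ 2 = 1 := fun j => by rcases hσ j with h | h <;> rw [h] <;> norm_num
  simp [this]

lemma norm_of_mem_cube {N : ℕ} {σ : Fin N → ℝ} (hσ : σ ∈ cube N) :
    ‖(WithLp.toLp 2 σ : EuclideanSpace ℝ (Fin N))‖ = √N := by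
  rw [← norm_sq_of_mem_cube hσ, Real.sqrt_sq (norm_nonneg _)]

/-- Bound on the exponential rate of the number of cube points in a ball of squared radius
`x N`. -/
noncomputable def ballRate (x : ℝ) : ℝ := x * Real.log (1 / x) + x

/-- Exponential Markov bound with tilt `log (1 / x)`; the resulting sum factorizes over coordinates.
The centre is arbitrary, but one of `±1` is at distance at least `1` from `y j`, so each coordinate
contributes at most `1 + x ≤ exp x`. -/
lemma card_cube_ball_le {N : ℕ} (y : Fin N → ℝ) {x : ℝ} (hx : 0 < x) (hx1 : x ≤ 1) :
    (((cubeFinset N).filter fun σ => ∑ j, (σ j - y j) ^ 2 ≤ x * N).card : ℝ) ≤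
      Real.exp (N * ballRate x) := by
  set l := Real.log (1 / x) with hl
  have hl0 : 0 ≤ l := Real.log_nonneg (by rw [le_div_iff₀ hx]; linarith)
  have hexp : Real.exp (-l) = x := by
    rw [hl, one_div, Real.log_inv, neg_neg, Real.exp_log hx]
  have h1 : (((cubeFinset N).filter fun σ => ∑ j, (σ j - y j) ^ 2 ≤ x * N).card : ℝ) ≤
      ∑ σ ∈ cubeFinset N, Real.exp (l * (x * N)) * ∏ j, Real.exp (-l * (σ j - y j) ^ 2) := by
    rw [Finset.card_eq_sum_ones, Nat.cast_sum]
    refine (Finset.sum_le_sum fun σ hσ => ?_).trans (Finset.sum_le_sum_of_subset_of_nonneg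
      (Finset.filter_subset _ _) fun σ _ _ => by positivity)
    rw [← Real.exp_sum, ← Real.exp_add, Nat.cast_one, Real.one_le_exp_iff, ← Finset.mul_sum]
    have := mul_le_mul_of_nonneg_left (Finset.mem_filter.1 hσ).2 hl0
    linarith
  refine h1.trans ?_
  rw [← Finset.mul_sum, cubeFinset,
    ← Finset.prod_univ_sum (fun _ : Fin N => ({1, -1} : Finset ℝ))
      (fun j s => Real.exp (-l * (s - y j) ^ 2))]
  have h2 : ∀ j : Fin N, ∑ s ∈ ({1, -1} : Finset ℝ), Real.exp (-l * (s - y j) ^ 2) ≤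
      Real.exp x := by
    intro j
    rw [Finset.sum_pair (by norm_num)]
    refine le_trans ?_ (Real.add_one_le_exp x)
    have h3 : ∀ z : ℝ, Real.exp (-l * z ^ 2) ≤ 1 := fun z =>
      Real.exp_le_one_iff.2 (by nlinarith [sq_nonneg z])
    have h4 : ∀ z : ℝ, 1 ≤ z ^ 2 → Real.exp (-l * z ^ 2) ≤ x := fun z hz => by
      rw [← hexp]
      exact Real.exp_le_exp.2 (by nlinarith)
    rcases le_total 0 (y j) with h | h
    · have := h3 (1 - y j)
      have := h4 (-1 - y j) (by nlinarith)
      linarith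
    · have := h3 (-1 - y j)
      have := h4 (1 - y j) (by nlinarith)
      linarith
  calc _ ≤ Real.exp (l * (x * N)) * ∏ _j : Fin N, Real.exp x := by
        gcongr with j _
        exact h2 j
    _ = _ := by
        rw [Finset.prod_const, Finset.card_univ, Fintype.card_fin, ← Real.exp_nat_mul,
          ← Real.exp_add, ballRate]
        congr 1
        ring

/-- Round the coordinates of the projection, in an orthonormal basis of `V`, to a mesh of width `√N
/ q`. They lie in `[-√N, √N]`, which leaves at most `(2q + 1) ^ m` cells. By Pythagoras each cell
lies in a ball of squared radius `(t ^ 2 + m / q ^ 2) N`. -/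
lemma card_cube_near_subspace_le {N m q : ℕ} (hq : 0 < q)
    (V : Submodule ℝ (EuclideanSpace ℝ (Fin N))) (hV : Module.finrank ℝ V ≤ m) {t x : ℝ}
    (hx : 0 < x) (hx1 : x ≤ 1) (htx : t ^ 2 + m / q ^ 2 ≤ x) :
    (((cubeFinset N).filter fun σ =>
      ‖WithLp.toLp 2 σ - V.starProjection (WithLp.toLp 2 σ)‖ ≤ t * √N).card : ℝ) ≤
      (2 * q + 1) ^ m * Real.exp (N * ballRate x) := by
  classical
  set B : ℕ := ⌊Real.exp (N * ballRate x)⌋₊ with hB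
  set bs := stdOrthonormalBasis ℝ V with hbs
  let c : (Fin N → ℝ) → Fin (Module.finrank ℝ V) → ℝ := fun σ i =>
    inner ℝ (bs i : EuclideanSpace ℝ (Fin N)) (WithLp.toLp 2 σ)
  let f : (Fin N → ℝ) → Fin (Module.finrank ℝ V) → ℤ := fun σ i => ⌊c σ i * (q / √N)⌋
  let T : Finset (Fin (Module.finrank ℝ V) → ℤ) :=
    Fintype.piFinset fun _ => Finset.Icc (-(q : ℤ)) q
  have hT : T.card ≤ (2 * q + 1) ^ m := by
    simp only [T]
    rw [Fintype.card_piFinset]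
    simp only [Int.card_Icc, Finset.prod_const, Finset.card_univ, Fintype.card_fin]
    have : ((q : ℤ) + 1 - -(q : ℤ)).toNat = 2 * q + 1 := by omega
    rw [this]
    exact Nat.pow_le_pow_right (by omega) hV
  rcases Nat.eq_zero_or_pos N with hN | hN
  · subst hN
    have h1 : (((cubeFinset 0).filter fun σ =>
        ‖WithLp.toLp 2 σ - V.starProjection (WithLp.toLp 2 σ)‖ ≤ t * √((0 : ℕ) : ℝ)).card : ℝ) ≤ 1 := by
      have := (Finset.card_filter_le (cubeFinset 0) fun σ =>
        ‖WithLp.toLp 2 σ - V.starProjection (WithLp.toLp 2 σ)‖ ≤ t * √((0 : ℕ) : ℝ)).trans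
        (card_cubeFinset 0).le
      exact_mod_cast this
    refine h1.trans ?_
    have : (1 : ℝ) ≤ (2 * q + 1) ^ m := one_le_pow₀ (by have : (0 : ℝ) ≤ q := by positivity
                                                        linarith)
    simpa using this
  have hN' : (0 : ℝ) < √N := Real.sqrt_pos.2 (by exact_mod_cast hN)
  have hq' : (0 : ℝ) < q := by exact_mod_cast hq
  have hc : ∀ σ ∈ cubeFinset N, ∀ i, |c σ i| ≤ √N := by
    intro σ hσ i
    refine (abs_real_inner_le_norm _ _).trans ?_
    have h1 : ‖(bs i : EuclideanSpace ℝ (Fin N))‖ = 1 := bs.orthonormal.1 i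
    rw [h1, one_mul, norm_of_mem_cube (mem_cubeFinset.1 hσ)]
  have hmaps : ∀ σ ∈ (cubeFinset N).filter fun σ =>
      ‖WithLp.toLp 2 σ - V.starProjection (WithLp.toLp 2 σ)‖ ≤ t * √N, f σ ∈ T := by
    intro σ hσ
    refine Fintype.mem_piFinset.2 fun i => ?_
    have h1 := abs_le.1 (hc σ (Finset.mem_filter.1 hσ).1 i)
    have h2 : |c σ i * (q / √N)| ≤ q := by
      rw [abs_mul, abs_of_pos (by positivity : (0 : ℝ) < q / √N)]
      calc |c σ i| * (q / √N) ≤ √N * (q / √N) := by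
            gcongr
            exact hc σ (Finset.mem_filter.1 hσ).1 i
        _ = q := by field_simp
    have h3 := abs_le.1 h2
    rw [Finset.mem_Icc]
    constructor
    · exact Int.le_floor.2 (by push_cast; exact h3.1)
    · have := (Int.floor_le (c σ i * (q / √N))).trans h3.2
      exact_mod_cast this
  have hfib : ∀ k ∈ T, (((cubeFinset N).filter fun σ =>
      ‖WithLp.toLp 2 σ - V.starProjection (WithLp.toLp 2 σ)‖ ≤ t * √N).filter
      fun σ => f σ = k).card ≤ B := by
    intro k _
    rw [hB]
    refine Nat.le_floor ?_
    let y : EuclideanSpace ℝ (Fin N) := ∑ i, (k i * (√N / q)) • (bs i : EuclideanSpace ℝ (Fin N))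
    refine le_trans ?_ (card_cube_ball_le (fun j => y j) hx hx1)
    rw [Nat.cast_le]
    refine Finset.card_le_card fun σ hσ => ?_
    simp only [Finset.mem_filter] at hσ ⊢
    obtain ⟨⟨hσc, hσt⟩, hσk⟩ := hσ
    refine ⟨hσc, ?_⟩
    have h0 : ∑ j, (σ j - y j) ^ 2 = ‖WithLp.toLp 2 σ - y‖ ^ 2 := by
      rw [EuclideanSpace.real_norm_sq_eq]
      rfl
    have hy : y ∈ V := V.sum_mem fun i _ => V.smul_mem _ (bs i).2
    set p := V.starProjection (WithLp.toLp 2 σ) with hp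
    have hpV : p ∈ V := Submodule.starProjection_apply_mem _ _
    have h1 : ‖WithLp.toLp 2 σ - y‖ ^ 2 = ‖WithLp.toLp 2 σ - p‖ ^ 2 + ‖p - y‖ ^ 2 := by
      have h2 : inner ℝ (WithLp.toLp 2 σ - p) (p - y) = 0 :=
        Submodule.inner_left_of_mem_orthogonal (V.sub_mem hpV hy)
          (Submodule.sub_starProjection_mem_orthogonal _)
      have := norm_add_sq_real (WithLp.toLp 2 σ - p) (p - y)
      rw [h2, sub_add_sub_cancel] at this
      linarith
    have h2 : p - y = ∑ i, (c σ i - k i * (√N / q)) • (bs i : EuclideanSpace ℝ (Fin N)) := by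
      have h3 : p = ∑ i, c σ i • (bs i : EuclideanSpace ℝ (Fin N)) := by
        rw [hp, bs.starProjection_eq_sum_rankOne]
        simp [c]
      rw [h3]
      simp only [y, sub_smul, Finset.sum_sub_distrib]
    have h3 : ‖p - y‖ ^ 2 = ∑ i, (c σ i - k i * (√N / q)) ^ 2 := by
      have h4 : p - y = ((∑ i, (c σ i - k i * (√N / q)) • bs i : V) : EuclideanSpace ℝ (Fin N)) := by
        rw [h2]; simp
      rw [h4, ← Submodule.coe_norm, ← bs.sum_sq_norm_inner_right]
      refine Finset.sum_congr rfl fun i _ => ?_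
      rw [bs.orthonormal.inner_right_fintype]
      simp
    have h4 : ∀ i, (c σ i - k i * (√N / q)) ^ 2 ≤ N / q ^ 2 := by
      intro i
      have h5 : k i = ⌊c σ i * (q / √N)⌋ := by rw [← hσk]
      have h6 := Int.floor_le (c σ i * (q / √N))
      have h7 := Int.lt_floor_add_one (c σ i * (q / √N))
      rw [← h5] at h6 h7
      have h8 : c σ i - k i * (√N / q) = (c σ i * (q / √N) - k i) * (√N / q) := by field_simp
      rw [h8, mul_pow, div_pow, Real.sq_sqrt (Nat.cast_nonneg N)]
      refine mul_le_of_le_one_left (by positivity) ?_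
      nlinarith
    have h5 : ‖p - y‖ ^ 2 ≤ m * (N / q ^ 2) := by
      rw [h3]
      refine (Finset.sum_le_sum fun i _ => h4 i).trans ?_
      rw [Finset.sum_const, Finset.card_univ, Fintype.card_fin, nsmul_eq_mul]
      gcongr
    have h6 : ‖WithLp.toLp 2 σ - p‖ ^ 2 ≤ t ^ 2 * N := by
      calc _ ≤ (t * √N) ^ 2 := by gcongr
        _ = _ := by rw [mul_pow, Real.sq_sqrt (Nat.cast_nonneg N)]
    rw [h0, h1]
    calc _ ≤ t ^ 2 * N + m * (N / q ^ 2) := add_le_add h6 h5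
      _ = (t ^ 2 + m / q ^ 2) * N := by ring
      _ ≤ x * N := by gcongr
  have := Finset.card_le_mul_card_image_of_maps_to hmaps B hfib
  calc _ ≤ ((B * T.card : ℕ) : ℝ) := by exact_mod_cast this
    _ ≤ Real.exp (N * ballRate x) * (2 * q + 1) ^ m := by
        push_cast
        gcongr
        · exact Nat.floor_le (Real.exp_pos _).le
        · exact_mod_cast hT
    _ = _ := mul_comm _ _

end Counting

/-! ### Tuples of points near the span of their predecessors. -/

section Tuples

/-- The distance of a point from a subspace. -/
noncomputable def residual {N : ℕ} (V : Submodule ℝ (EuclideanSpace ℝ (Fin N))) (σ : Fin N → ℝ) :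
    ℝ :=
  ‖WithLp.toLp 2 σ - V.starProjection (WithLp.toLp 2 σ)‖

lemma residual_le_add {N : ℕ} (V : Submodule ℝ (EuclideanSpace ℝ (Fin N))) (σ τ : Fin N → ℝ) :
    residual V σ ≤ residual V τ + ‖(WithLp.toLp 2 σ : EuclideanSpace ℝ (Fin N)) - WithLp.toLp 2 τ‖ := by
  have h : ∀ v : EuclideanSpace ℝ (Fin N), v - V.starProjection v = Vᗮ.starProjection v := fun v => by
    rw [Submodule.starProjection_orthogonal']; simp
  rw [residual, residual, h, h]
  calc _ = ‖Vᗮ.starProjection (WithLp.toLp 2 τ) +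
        Vᗮ.starProjection (WithLp.toLp 2 σ - WithLp.toLp 2 τ)‖ := by
        rw [← map_add]; simp
    _ ≤ _ := (norm_add_le _ _).trans (add_le_add_right (Submodule.norm_starProjection_apply_le _ _) _)

/-- The span of the entries of a tuple with index less than `j`. -/
noncomputable def spanBefore {N n : ℕ} (σ : Fin n → Fin N → ℝ) (j : ℕ) :
    Submodule ℝ (EuclideanSpace ℝ (Fin N)) :=
  Submodule.span ℝ ((fun i => WithLp.toLp 2 (σ i)) '' {i | (i : ℕ) < j})

lemma spanBefore_init {N n : ℕ} (σ : Fin (n + 1) → Fin N → ℝ) {j : ℕ} (hj : j ≤ n) :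
    spanBefore (Fin.init σ) j = spanBefore σ j := by
  unfold spanBefore
  congr 1
  ext v
  constructor
  · rintro ⟨i, hi, rfl⟩
    exact ⟨i.castSucc, hi, rfl⟩
  · rintro ⟨i, hi, rfl⟩
    have hi' : (i : ℕ) < j := hi
    exact ⟨⟨i, by omega⟩, hi', rfl⟩

lemma finrank_spanBefore_le {N n : ℕ} (σ : Fin n → Fin N → ℝ) (j : ℕ) :
    Module.finrank ℝ (spanBefore σ j) ≤ n := by
  classical
  have h : (fun i => (WithLp.toLp 2 (σ i) : EuclideanSpace ℝ (Fin N))) '' {i | (i : ℕ) < j} =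
      (((Finset.univ.filter fun i : Fin n => (i : ℕ) < j).image fun i => WithLp.toLp 2 (σ i) :
        Finset (EuclideanSpace ℝ (Fin N))) : Set (EuclideanSpace ℝ (Fin N))) := by
    ext; simp
  rw [spanBefore, h]
  refine (finrank_span_finset_le_card _).trans (Finset.card_image_le.trans ?_)
  exact (Finset.card_filter_le _ _).trans (by simp)

open Classical in
/-- Tuples of cube points each of which is near the span of its predecessors. -/
noncomputable def nearTuples (N n : ℕ) (t : ℝ) : Finset (Fin (n + 1) → Fin N → ℝ) :=
  (Fintype.piFinset fun _ => cubeFinset N).filter fun σ =>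
    ∀ j : Fin (n + 1), 0 < (j : ℕ) → residual (spanBefore σ j) (σ j) ≤ t * √N

lemma mem_nearTuples {N n : ℕ} {t : ℝ} {σ : Fin (n + 1) → Fin N → ℝ} :
    σ ∈ nearTuples N n t ↔ (∀ j, σ j ∈ cube N) ∧
      ∀ j : Fin (n + 1), 0 < (j : ℕ) → residual (spanBefore σ j) (σ j) ≤ t * √N := by
  simp [nearTuples, mem_cubeFinset]

/-- The first point is free, which gives `2 ^ N`. Every later point lies near a subspace of
dimension at most `m` determined by the earlier ones. -/
lemma card_nearTuples_le {N m q : ℕ} (hq : 0 < q) {t x : ℝ} (hx : 0 < x) (hx1 : x ≤ 1)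
    (htx : t ^ 2 + m / q ^ 2 ≤ x) {n : ℕ} (hn : n ≤ m) :
    ((nearTuples N n t).card : ℝ) ≤
      2 ^ N * ((2 * q + 1) ^ m * Real.exp (N * ballRate x)) ^ n := by
  classical
  induction n with
  | zero =>
    have h : (nearTuples N 0 t).card ≤ 2 ^ N := by
      refine (Finset.card_filter_le _ _).trans ?_
      rw [Fintype.card_piFinset]
      simp [card_cubeFinset]
    rw [pow_zero, mul_one]
    exact_mod_cast h
  | succ n ih =>
    set B : ℝ := (2 * q + 1) ^ m * Real.exp (N * ballRate x) with hB
    have hB0 : 0 ≤ B := by positivity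
    have hmaps : ∀ σ ∈ nearTuples N (n + 1) t, (Fin.init σ : Fin (n + 1) → Fin N → ℝ) ∈
        nearTuples N n t := by
      intro σ hσ
      rw [mem_nearTuples] at hσ ⊢
      refine ⟨fun j => hσ.1 j.castSucc, fun j hj => ?_⟩
      rw [spanBefore_init σ (by omega)]
      exact hσ.2 j.castSucc hj
    have hfib : ∀ τ ∈ nearTuples N n t,
        ((nearTuples N (n + 1) t).filter fun σ => Fin.init σ = τ).card ≤ ⌊B⌋₊ := by
      intro τ _
      refine Nat.le_floor ?_
      refine le_trans ?_ (card_cube_near_subspace_le hq (spanBefore τ (n + 1))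
        ((finrank_spanBefore_le τ (n + 1)).trans hn) hx hx1 htx)
      rw [Nat.cast_le]
      refine Finset.card_le_card_of_injOn (fun σ => σ (Fin.last (n + 1))) ?_ ?_
      · intro σ hσ
        obtain ⟨h1, rfl⟩ := Finset.mem_filter.1 hσ
        rw [mem_nearTuples] at h1
        refine Finset.mem_filter.2 ⟨mem_cubeFinset.2 (h1.1 _), ?_⟩
        have := h1.2 (Fin.last (n + 1)) (by simp)
        rw [Fin.val_last, ← spanBefore_init σ le_rfl] at this
        exact this
      · intro σ hσ σ' hσ' hlast
        have h1 : Fin.init σ = τ := (Finset.mem_filter.1 hσ).2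
        have h2 : Fin.init σ' = τ := (Finset.mem_filter.1 hσ').2
        rw [← Fin.snoc_init_self σ, ← Fin.snoc_init_self σ', h1, h2]
        have h3 : σ (Fin.last (n + 1)) = σ' (Fin.last (n + 1)) := hlast
        rw [h3]
    have h := Finset.card_le_mul_card_image_of_maps_to hmaps _ hfib
    calc ((nearTuples N (n + 1) t).card : ℝ) ≤ ((⌊B⌋₊ * (nearTuples N n t).card : ℕ) : ℝ) := by
          exact_mod_cast h
      _ ≤ B * (2 ^ N * B ^ n) := by
          push_cast
          gcongr
          · exact Nat.floor_le hB0
          · exact ih (by omega)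
      _ = _ := by ring

end Tuples

/-! ### Extracting an admissible tuple from a slow path. -/

section Extraction

variable {N : ℕ}

/-- Along a slowly moving path, the next time at which the path is at the right distance from a
subspace, or the end of the time window. -/
lemma exists_next_time {τ : ℕ → Fin N → ℝ} (V : Submodule ℝ (EuclideanSpace ℝ (Fin N)))
    {k₀ L : ℕ} (hL : 0 < L) (hk₀ : WithLp.toLp 2 (τ k₀) ∈ V) {s η t : ℝ} (hs : 0 ≤ s)
    (hst : s + η ≤ t)
    (hstep : ∀ k < k₀ + L, ‖(WithLp.toLp 2 (τ (k + 1)) : EuclideanSpace ℝ (Fin N)) -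
      WithLp.toLp 2 (τ k)‖ ≤ η * √N) :
    ∃ k, k₀ < k ∧ k ≤ k₀ + L ∧ residual V (τ k) ≤ t * √N ∧
      (s * √N ≤ residual V (τ k) ∨ k₀ + L ≤ k) := by
  classical
  have hN : 0 ≤ √(N : ℝ) := Real.sqrt_nonneg _
  -- Take the least such time. One step earlier the residual is below `s √N`, or zero if that time
  -- is `k₀`, and a single step adds at most `η √N`.
  have hex : ∃ k, k₀ < k ∧ (s * √N ≤ residual V (τ k) ∨ k₀ + L ≤ k) :=
    ⟨k₀ + L, by omega, Or.inr le_rfl⟩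
  obtain ⟨h1, h2⟩ := Nat.find_spec hex
  have hle : Nat.find hex ≤ k₀ + L := Nat.find_min' hex ⟨by omega, Or.inr le_rfl⟩
  refine ⟨Nat.find hex, h1, hle, ?_, h2⟩
  obtain ⟨k, hk⟩ : ∃ k, Nat.find hex = k + 1 := ⟨Nat.find hex - 1, by omega⟩
  have hprev : residual V (τ k) ≤ s * √N := by
    rcases Nat.lt_or_ge k₀ k with h | h
    · have := Nat.find_min hex (m := k) (by omega)
      push Not at this
      exact (this h).1.le
    · have : k = k₀ := by omega
      rw [this, residual, Submodule.starProjection_eq_self_iff.2 hk₀, sub_self, norm_zero]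
      positivity
  rw [hk]
  calc residual V (τ (k + 1)) ≤ s * √N + η * √N :=
        (residual_le_add V _ (τ k)).trans (add_le_add hprev (hstep k (by omega)))
    _ = (s + η) * √N := by ring
    _ ≤ t * √N := by gcongr

/-- The span of the points of a path visited at the times `k 0, …, k j`. -/
noncomputable def spanUpTo (τ : ℕ → Fin N → ℝ) (k : ℕ → ℕ) (j : ℕ) :
    Submodule ℝ (EuclideanSpace ℝ (Fin N)) :=
  Submodule.span ℝ ((fun i => WithLp.toLp 2 (τ (k i))) '' {i | i ≤ j})

/-- Iterates `exists_next_time` with the span of all points chosen so far. It contains the current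
point, so the residual restarts from zero, and each round uses at most `L` steps. -/
lemma exists_times {τ : ℕ → Fin N → ℝ} {L K : ℕ} (hL : 0 < L) {s η t : ℝ} (hs : 0 ≤ s)
    (hst : s + η ≤ t)
    (hstep : ∀ k < K, ‖(WithLp.toLp 2 (τ (k + 1)) : EuclideanSpace ℝ (Fin N)) -
      WithLp.toLp 2 (τ k)‖ ≤ η * √N) (n : ℕ) (hn : n * L ≤ K) :
    ∃ k : ℕ → ℕ, (∀ j ≤ n, k j ≤ j * L) ∧ ∀ j < n, k j < k (j + 1) ∧
      residual (spanUpTo τ k j) (τ (k (j + 1))) ≤ t * √N ∧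
      (s * √N ≤ residual (spanUpTo τ k j) (τ (k (j + 1))) ∨ k j + L ≤ k (j + 1)) := by
  induction n with
  | zero => exact ⟨fun _ => 0, by simp, by simp⟩
  | succ n ih =>
    have hmul : (n + 1) * L = n * L + L := by ring
    obtain ⟨k, hk1, hk2⟩ := ih (by omega)
    have hkn := hk1 n le_rfl
    obtain ⟨k', h1, h2, h3, h4⟩ := exists_next_time (τ := τ) (spanUpTo τ k n) (k₀ := k n) hL
      (Submodule.subset_span ⟨n, le_refl n, rfl⟩) hs hst fun j hj => hstep j (by omega)
    have hupd : ∀ i ≤ n, Function.update k (n + 1) k' i = k i := fun i hi =>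
      Function.update_of_ne (by omega) _ _
    have hspan : ∀ j ≤ n, spanUpTo τ (Function.update k (n + 1) k') j = spanUpTo τ k j := by
      intro j hj
      unfold spanUpTo
      congr 1
      refine Set.image_congr fun i hi => ?_
      rw [hupd i (le_trans hi hj)]
    refine ⟨Function.update k (n + 1) k', fun j hj => ?_, fun j hj => ?_⟩
    · rcases Nat.lt_or_ge n j with h | h
      · have : j = n + 1 := by omega
        subst this
        rw [Function.update_self]
        omega
      · rw [hupd j h]
        exact hk1 j h
    · rw [hspan j (by omega), hupd j (by omega)]
      rcases Nat.lt_or_ge j n with h | h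
      · rw [hupd (j + 1) (by omega)]
        exact hk2 j h
      · have : j = n := by omega
        subst this
        rw [Function.update_self]
        exact ⟨h1, h3, h4⟩

/-- A tuple of cube points visited at the times `k` for which each point is either far from the
span of its predecessors, or visited much later. -/
def Admissible (s : ℝ) (L : ℕ) {n : ℕ} (σ : Fin n → Fin N → ℝ) (k : Fin n → ℕ) : Prop :=
  ∀ j, (∃ e : Fin N → ℝ, ∑ l, e l ^ 2 = 1 ∧ (∀ i < j, ∑ l, e l * σ i l = 0) ∧
    s * √N ≤ ∑ l, e l * σ j l) ∨ (L ≤ k j ∧ ∀ i < j, k i + L ≤ k j)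

lemma exists_unit_of_le_residual {V : Submodule ℝ (EuclideanSpace ℝ (Fin N))} {σ : Fin N → ℝ}
    {r : ℝ} (hr : 0 < r) (h : r ≤ residual V σ) :
    ∃ e : Fin N → ℝ, ∑ l, e l ^ 2 = 1 ∧ (∀ v ∈ V, ∑ l, e l * v l = 0) ∧ r ≤ ∑ l, e l * σ l := by
  have hpos : 0 < residual V σ := hr.trans_le h
  set v := (WithLp.toLp 2 σ : EuclideanSpace ℝ (Fin N)) with hv
  set w := v - V.starProjection v with hw
  have hwn : ‖w‖ = residual V σ := rfl
  have hworth : w ∈ Vᗮ := Submodule.sub_starProjection_mem_orthogonal _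
  have hinner : ∀ a b : EuclideanSpace ℝ (Fin N), inner ℝ a b = ∑ l, a l * b l := fun a b => by
    simp [PiLp.inner_apply, mul_comm]
  refine ⟨fun l => (‖w‖⁻¹ • w) l, ?_, fun u hu => ?_, ?_⟩
  · rw [← EuclideanSpace.real_norm_sq_eq, norm_smul, norm_inv, norm_norm,
      inv_mul_cancel₀ (by rw [hwn]; exact hpos.ne'), one_pow]
  · rw [← hinner, inner_smul_left, Submodule.inner_left_of_mem_orthogonal hu hworth, mul_zero]
  · have h1 : inner ℝ (‖w‖⁻¹ • w) v = ‖w‖ := by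
      have h2 : v = w + V.starProjection v := by rw [hw]; abel
      have h3 : inner ℝ w v = ‖w‖ ^ 2 := by
        conv_lhs => rw [h2]
        rw [inner_add_right, Submodule.inner_left_of_mem_orthogonal
          (Submodule.starProjection_apply_mem _ _) hworth, add_zero, real_inner_self_eq_norm_sq]
      rw [inner_smul_left, h3]
      have : ‖w‖ ≠ 0 := by rw [hwn]; exact hpos.ne'
      simp
      field_simp
    rw [hinner] at h1
    rw [← hwn, ← h1] at h
    exact h

/-- A slowly moving path in the cube contains an admissible tuple of near points. -/
lemma exists_admissible (hN : 0 < N) {τ : ℕ → Fin N → ℝ} (hτ : ∀ k, τ k ∈ cube N) {L K : ℕ}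
    (hL : 0 < L) {s η t : ℝ} (hs : 0 < s) (hs1 : s ≤ 1) (hst : s + η ≤ t)
    (hstep : ∀ k < K, ‖(WithLp.toLp 2 (τ (k + 1)) : EuclideanSpace ℝ (Fin N)) -
      WithLp.toLp 2 (τ k)‖ ≤ η * √N) (n : ℕ) (hn : n * L ≤ K) :
    ∃ k : Fin (n + 1) → ℕ, (∀ j, k j ≤ K) ∧ (fun j => τ (k j)) ∈ nearTuples N n t ∧
      Admissible s L (fun j => τ (k j)) k := by
  obtain ⟨k, hk1, hk2⟩ := exists_times hL hs.le hst hstep n hn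
  have hN' : 0 < √(N : ℝ) := Real.sqrt_pos.2 (by exact_mod_cast hN)
  have hspan : ∀ j < n, spanBefore (fun i : Fin (n + 1) => τ (k i)) (j + 1) = spanUpTo τ k j := by
    intro j hj
    unfold spanBefore spanUpTo
    congr 1
    ext v
    constructor
    · rintro ⟨i, hi, rfl⟩
      exact ⟨i, Nat.lt_succ_iff.1 hi, rfl⟩
    · rintro ⟨i, hi, rfl⟩
      have hi' : i ≤ j := hi
      exact ⟨⟨i, by omega⟩, Nat.lt_succ_iff.2 hi', rfl⟩
  have hmono : ∀ i j, i ≤ j → j ≤ n → k i ≤ k j := by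
    intro i j hij
    induction j, hij using Nat.le_induction with
    | base => exact fun _ => le_rfl
    | succ j _ ih => exact fun hj => (ih (by omega)).trans (hk2 j (by omega)).1.le
  refine ⟨fun j => k j, fun j => (hk1 j (by omega)).trans
    ((Nat.mul_le_mul_right L (by omega)).trans hn), ?_, fun j => ?_⟩
  · refine mem_nearTuples.2 ⟨fun j => hτ _, fun j hj => ?_⟩
    obtain ⟨i, hi⟩ : ∃ i, (j : ℕ) = i + 1 := ⟨j - 1, by omega⟩
    rw [hi, hspan i (by omega)]
    have h := (hk2 i (by omega)).2.1
    rw [← hi] at h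
    exact h
  · rcases Nat.eq_zero_or_pos (j : ℕ) with hj | hj
    -- The first point has no predecessors and serves as its own direction; its component is `√N`,
    -- hence the need for `s ≤ 1`.
    · refine Or.inl ⟨fun l => τ (k j) l / √N, ?_, fun i hi => absurd hi (by
        rw [Fin.lt_def]; omega), ?_⟩
      · have h1 := norm_sq_of_mem_cube (hτ (k j))
        rw [EuclideanSpace.real_norm_sq_eq] at h1
        simp only [div_pow, ← Finset.sum_div, Real.sq_sqrt (Nat.cast_nonneg N)]
        rw [div_eq_one_iff_eq (by positivity)]
        exact h1
      · have h1 := norm_sq_of_mem_cube (hτ (k j))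
        rw [EuclideanSpace.real_norm_sq_eq] at h1
        have h2 : ∑ l, τ (k j) l / √N * τ (k j) l = √N := by
          simp only [div_mul_eq_mul_div, ← Finset.sum_div, ← sq]
          rw [div_eq_iff hN'.ne', ← sq, Real.sq_sqrt (Nat.cast_nonneg N)]
          exact h1
        rw [h2]
        exact mul_le_of_le_one_left hN'.le hs1
    · obtain ⟨p, hp⟩ : ∃ p, (j : ℕ) = p + 1 := ⟨j - 1, by omega⟩
      obtain ⟨h1, h2, h3⟩ := hk2 p (by omega)
      rcases h3 with h3 | h3
      · left
        rw [← hp] at h3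
        obtain ⟨e, he1, he2, he3⟩ := exists_unit_of_le_residual (by positivity) h3
        refine ⟨e, he1, fun i hi => ?_, he3⟩
        refine he2 (WithLp.toLp 2 (τ (k i))) (Submodule.subset_span ⟨i, ?_, rfl⟩)
        have := Fin.lt_def.1 hi
        exact Nat.lt_succ_iff.1 (by omega)
      · right
        rw [← hp] at h3
        refine ⟨by change L ≤ k j; omega, fun i hi => ?_⟩
        have := Fin.lt_def.1 hi
        have := hmono i p (by omega) (by omega)
        change k i + L ≤ k j
        omega

end Extraction

/-! ### How much of a state is fresh noise. -/

section ChainCoefficients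

variable {a b : ℝ}

lemma sum_sq_chainCoeff (h : a ^ 2 + b ^ 2 = 1) {n k : ℕ} (hk : k ≤ n) :
    ∑ i : Fin (n + 1), chainCoeff a b k i ^ 2 = 1 := by
  rw [Fin.sum_univ_eq_sum_range (fun i => chainCoeff a b k i ^ 2)]
  induction k with
  | zero => simp [chainCoeff]
  | succ k ih =>
    have h1 : ∀ i, chainCoeff a b (k + 1) i ^ 2 =
        a ^ 2 * chainCoeff a b k i ^ 2 + if i = k + 1 then b ^ 2 else 0 := by
      intro i
      rw [chainCoeff]
      split_ifs with hi
      · rw [hi, chainCoeff_of_lt (Nat.lt_succ_self k)]; ring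
      · ring
    simp_rw [h1]
    rw [Finset.sum_add_distrib, ← Finset.mul_sum, ih (by omega), Finset.sum_ite_eq',
      if_pos (Finset.mem_range.2 (by omega)), mul_one, h]

lemma chainCoeff_add {p i : ℕ} (hi : i ≤ p) (L : ℕ) :
    chainCoeff a b (p + L) i = a ^ L * chainCoeff a b p i := by
  induction L with
  | zero => simp
  | succ L ih =>
    rw [← add_assoc, chainCoeff, if_neg (by omega), ih, pow_succ]
    ring

/-- After `L` steps the noise present at time `p` has been damped by `a ^ L`. Since the total weight
stays `1`, the noise that entered later carries the rest. -/
lemma sum_sq_chainCoeff_fresh (h : a ^ 2 + b ^ 2 = 1) {n p L : ℕ} (hp : p + L ≤ n) :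
    ∑ i : Fin (n + 1), (if p < (i : ℕ) then chainCoeff a b (p + L) i ^ 2 else 0) =
      1 - a ^ (2 * L) := by
  have h1 : ∀ i : Fin (n + 1), (if p < (i : ℕ) then chainCoeff a b (p + L) i ^ 2 else 0) =
      chainCoeff a b (p + L) i ^ 2 - a ^ (2 * L) * chainCoeff a b p i ^ 2 := by
    intro i
    split_ifs with hi
    · rw [chainCoeff_of_lt hi]; ring
    · rw [chainCoeff_add (not_lt.1 hi)]; ring
  simp_rw [h1]
  rw [Finset.sum_sub_distrib, ← Finset.mul_sum, sum_sq_chainCoeff h hp,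
    sum_sq_chainCoeff h (by omega), mul_one]

end ChainCoefficients

/-! ### First moment bound over admissible tuples. -/

section UnionBound

variable {M N : ℕ} {a b : ℝ}

lemma smallBall_admissible (hN : 0 < N) (h : a ^ 2 + b ^ 2 = 1) {m K L : ℕ}
    {σ : Fin m → Fin N → ℝ} (hσ : ∀ j, σ j ∈ cube N) {k : Fin m → ℕ} (hk : ∀ j, k j ≤ K)
    {s κ : ℝ} (hs : 0 < s) (hκ : 0 ≤ κ) (hL : s ^ 2 ≤ 1 - a ^ (2 * L))
    (hadm : Admissible s L σ k) :
    (Measure.pi fun _ : Fin (K + 1) => disorderLaw M N)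
      {W | ∀ j (i : Fin M), |(∑ l, chainState a b W (k j) (i, l) * σ j l) / √N| ≤ κ} ≤
      ENNReal.ofReal (2 * κ / (√(2 * Real.pi) * s)) ^ (m * M) := by
  have hN' : 0 < √(N : ℝ) := Real.sqrt_pos.2 (by exact_mod_cast hN)
  have hsq : √(N : ℝ) ^ 2 = N := Real.sq_sqrt (Nat.cast_nonneg N)
  have hstate : ∀ (W : Fin (K + 1) → Disorder M N) (j : ℕ) (p : Fin M × Fin N),
      chainState a b W j p = ∑ t : Fin (K + 1), chainCoeff a b j t * W t p := by
    intro W j p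
    simp [chainState]
  simp_rw [hstate]
  refine smallBall_rows (fun j (t : Fin (K + 1)) => chainCoeff a b (k j) t) σ hκ hs fun j => ?_
  have hσn : ∑ l, σ j l ^ 2 = N := by
    have := norm_sq_of_mem_cube (hσ j)
    rwa [EuclideanSpace.real_norm_sq_eq] at this
  rcases hadm j with ⟨e, he1, he2, he3⟩ | ⟨h1, h2⟩
  -- Far from the span: `e` gives orthogonality in space, and the noise vector is the full
  -- coefficient vector of the state at time `k j`.
  · refine ⟨fun t => chainCoeff a b (k j) t, e, ?_, fun i hi => ?_, ?_⟩
    · rw [he1, sum_sq_chainCoeff h (hk j), mul_one]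
    · rw [he2 i hi, mul_zero]
    · simp only [← sq]
      rw [sum_sq_chainCoeff h (hk j), one_mul, le_div_iff₀ hN']
      exact he3
  · obtain ⟨p, hp⟩ : ∃ p, k j = p + L := ⟨k j - L, by omega⟩
    have hw := sum_sq_chainCoeff_fresh (a := a) (b := b) h (n := K) (p := p) (L := L)
      (by rw [← hp]; exact hk j)
    rw [← hp] at hw
    set w := 1 - a ^ (2 * L) with hwdef
    have hw0 : 0 < w := lt_of_lt_of_le (by positivity) hL
    have hws : √w ^ 2 = w := Real.sq_sqrt hw0.le
    have hws0 : 0 < √w := Real.sqrt_pos.2 hw0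
    -- Visited much later: the normalized noise entering after time `p = k j - L` is invisible to
    -- all earlier chosen states, and the spatial direction is `σ j` itself.
    refine ⟨fun t => (if p < (t : ℕ) then chainCoeff a b (k j) t else 0) / √w,
      fun l => σ j l / √N, ?_, fun i hi => ?_, ?_⟩
    · simp only [div_pow, ← Finset.sum_div, hws, hsq, hσn]
      have : ∀ t : Fin (K + 1), (if p < (t : ℕ) then chainCoeff a b (k j) t else 0) ^ 2 =
          if p < (t : ℕ) then chainCoeff a b (k j) t ^ 2 else 0 := fun t => by
        split_ifs <;> simp
      simp only [this, hw]
      rw [div_self hw0.ne', div_self (by positivity), one_mul]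
    · have : ∀ t : Fin (K + 1), (if p < (t : ℕ) then chainCoeff a b (k j) t else 0) / √w *
          chainCoeff a b (k i) t = 0 := by
        intro t
        split_ifs with ht
        · have := h2 i hi
          rw [chainCoeff_of_lt (k := k i) (by omega), mul_zero]
        · simp
      simp [this]
    · have e1 : ∑ t : Fin (K + 1), (if p < (t : ℕ) then chainCoeff a b (k j) t else 0) / √w *
          chainCoeff a b (k j) t = √w := by
        have : ∀ t : Fin (K + 1), (if p < (t : ℕ) then chainCoeff a b (k j) t else 0) / √w *
            chainCoeff a b (k j) t =
            (if p < (t : ℕ) then chainCoeff a b (k j) t ^ 2 else 0) / √w := fun t => by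
          split_ifs
          · ring
          · simp
        simp_rw [this]
        rw [← Finset.sum_div, hw, div_eq_iff hws0.ne', ← sq, hws]
      have e2 : ∑ l, σ j l / √N * σ j l = √N := by
        simp only [div_mul_eq_mul_div, ← Finset.sum_div, ← sq]
        rw [div_eq_iff hN'.ne', ← sq, hsq, hσn]
      rw [e1, e2, mul_div_cancel_right₀ _ hN'.ne']
      exact Real.le_sqrt_of_sq_le hL

/-- First moment bound on the probability that all transitions of the chain are stable pairs. -/
lemma measure_pathSet_stablePairs_le (hN : 0 < N) (h : a ^ 2 + b ^ 2 = 1)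
    {F : Disorder M N → Fin N → ℝ} (hF : ∀ G, F G ∈ cube N) {n K L : ℕ} (hL0 : 0 < L)
    (hK : 0 < K) (hn : n * L ≤ K) {s t η κ : ℝ} (hs : 0 < s) (hs1 : s ≤ 1) (hη : 0 ≤ η)
    (hst : s + η ≤ t) (hκ : 0 ≤ κ) (hL : s ^ 2 ≤ 1 - a ^ (2 * L)) :
    (Measure.pi fun _ : Fin (K + 1) => disorderLaw M N)
      (pathSet a b (stablePairs F (Set.Icc (-κ) κ) (η ^ 2 * N)) K) ≤
      (nearTuples N n t).card * (((K + 1) ^ (n + 1) : ℕ) *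
        ENNReal.ofReal (2 * κ / (√(2 * Real.pi) * s)) ^ ((n + 1) * M)) := by
  classical
  -- For fixed `σ` and `k` the event no longer involves `F`, so the forms are Gaussian with
  -- deterministic coefficients. Admissibility does not depend on `W`, so inadmissible pairs give
  -- empty events.
  let Ev : (Fin (n + 1) → Fin N → ℝ) → (Fin (n + 1) → ℕ) → Set (Fin (K + 1) → Disorder M N) :=
    fun σ k => {W | Admissible s L σ k ∧
      ∀ j (i : Fin M), |(∑ l, chainState a b W (k j) (i, l) * σ j l) / √N| ≤ κ}
  let T : Finset (Fin (n + 1) → ℕ) := Fintype.piFinset fun _ => Finset.range (K + 1)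
  have hsub : pathSet a b (stablePairs F (Set.Icc (-κ) κ) (η ^ 2 * N)) K ⊆
      ⋃ σ ∈ nearTuples N n t, ⋃ k ∈ T, Ev σ k := by
    intro W hW
    have hsol : ∀ k ≤ K, F (chainState a b W k) ∈
        solutions (chainState a b W k) (Set.Icc (-κ) κ) := by
      intro k hk
      rcases Nat.lt_or_ge k K with hkK | hkK
      · exact (hW k hkK).1
      · obtain ⟨p, hp⟩ : ∃ p, k = p + 1 := ⟨k - 1, by omega⟩
        rw [hp]
        exact (hW p (by omega)).2.1
    obtain ⟨k, hkK, hnear, hadm⟩ := exists_admissible hN (τ := fun k => F (chainState a b W k))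
      (fun k => hF _) (K := K) hL0 hs hs1 hst (fun k hk => by
        have h1 := (hW k hk).2.2
        rw [← abs_of_nonneg (norm_nonneg _), ← abs_of_nonneg (mul_nonneg hη (Real.sqrt_nonneg _)),
          ← sq_le_sq, EuclideanSpace.real_norm_sq_eq, mul_pow, Real.sq_sqrt (Nat.cast_nonneg N)]
        refine le_of_eq_of_le (Finset.sum_congr rfl fun j _ => ?_) h1
        simp only [PiLp.sub_apply]
        ring) n hn
    simp only [Set.mem_iUnion]
    refine ⟨_, hnear, k, Fintype.mem_piFinset.2 fun j => Finset.mem_range.2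
      (Nat.lt_succ_of_le (hkK j)), hadm, fun j i => abs_le.2 ?_⟩
    exact (hsol (k j) (hkK j)).2 i
  refine (measure_mono hsub).trans ((measure_biUnion_finset_le _ _).trans ?_)
  rw [← nsmul_eq_mul]
  refine Finset.sum_le_card_nsmul _ _ _ fun σ hσ => ?_
  refine (measure_biUnion_finset_le _ _).trans ?_
  have hT : T.card = (K + 1) ^ (n + 1) := by simp [T, Fintype.card_piFinset]
  rw [← hT, ← nsmul_eq_mul]
  refine Finset.sum_le_card_nsmul _ _ _ fun k hk => ?_
  by_cases hadm : Admissible s L σ k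
  · refine (measure_mono fun W hW => hW.2).trans
      (smallBall_admissible hN h (mem_nearTuples.1 hσ).1 (fun j => ?_) hs hκ hL hadm)
    exact Nat.lt_succ_iff.1 (Finset.mem_range.1 (Fintype.mem_piFinset.1 hk j))
  · refine (measure_mono_null (t := ∅) (fun W hW => hadm hW.1) (by simp)).le.trans zero_le

end UnionBound

/-! ### Choice of constants and quantitative hardness. -/

section Hardness

/-- With `s = 4κ/3` the ratio does not depend on `κ`, and the claim becomes `9 e ≤ 8 π`. -/
lemma small_ball_ratio_le {κ : ℝ} (hκ : 0 < κ) :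
    2 * κ / (√(2 * Real.pi) * (4 / 3 * κ)) ≤ Real.exp (-(1 / 2)) := by
  have h1 : 2 * κ / (√(2 * Real.pi) * (4 / 3 * κ)) = 3 / (2 * √(2 * Real.pi)) := by
    field_simp
    ring
  rw [h1]
  refine (sq_le_sq₀ (by positivity) (Real.exp_pos _).le).1 ?_
  rw [div_pow, mul_pow, Real.sq_sqrt (by positivity), ← Real.exp_nat_mul]
  have h2 : Real.exp ((2 : ℕ) * -(1 / 2)) = (Real.exp 1)⁻¹ := by
    rw [← Real.exp_neg]; norm_num
  rw [h2, div_le_iff₀ (by positivity), inv_mul_eq_div, le_div_iff₀ (Real.exp_pos 1)]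
  have := Real.exp_one_lt_d9
  have := Real.pi_gt_d2
  nlinarith

/-- If a polynomial algorithm succeeds with probability at least `δ`, then the probability that a
whole chain of `2 ^ r` transitions is stable and solved is not too small; hence the first moment
bound is not too small either. -/
lemma pow_le_of_le_successProbability {M N D : ℕ} {Ω : Type*} [MeasurableSpace Ω]
    (hN : 0 < N) (μ : Measure Ω) [IsProbabilityMeasure μ]
    {A : Disorder M N → Ω → EuclideanSpace ℝ (Fin N)} (hAm : Measurable (Function.uncurry A))
    (hA : IsPolynomialOfDegree D A) {C δ κ a b s η t l : ℝ} (hC : 0 ≤ C)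
    (hAC : secondMoment μ A ≤ ENNReal.ofReal (C * N)) (hδ : 0 < δ)
    (hsucc : δ ≤ successProbability μ A (Set.Icc (-κ) κ)) (ha : 0 ≤ a) (hb : 0 < b)
    (h : a ^ 2 + b ^ 2 = 1) (hl : 0 < l) (hκ : 0 ≤ κ) (hs : 0 < s) (hs1 : s ≤ 1) (hη : 0 < η)
    (hst : s + η ≤ t) (herr : l + l⁻¹ * (2 * ((D + 1) * (1 - a)) * C) ≤ δ ^ 2 / 2 * η ^ 2)
    {n L r : ℕ} (hL0 : 0 < L) (hnr : n * L ≤ 2 ^ r) (hL : s ^ 2 ≤ 1 - a ^ (2 * L)) :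
    (δ ^ 2 / 2) ^ 2 ^ r ≤ (nearTuples N n t).card * ((2 ^ r + 1) ^ (n + 1) *
      (2 * κ / (√(2 * Real.pi) * s)) ^ ((n + 1) * M)) := by
  have hN' : (0 : ℝ) < N := by exact_mod_cast hN
  have ha1 : a ≤ 1 := by nlinarith [sq_nonneg b]
  have hθ : 0 < η ^ 2 * (N : ℝ) := by positivity
  obtain ⟨F, hFm, hFc, hF⟩ := exists_stable_seed ha hb h μ hAm hA
    (measurableSet_Icc : MeasurableSet (Set.Icc (-κ) κ)) hθ hl
  set Q := ∫⁻ x, transfer a b (stablePairs F (Set.Icc (-κ) κ) (η ^ 2 * N)) 1 x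
    ∂(disorderLaw M N) with hQ
  have h1a : 0 ≤ 2 * ((D + 1) * (1 - a)) := mul_nonneg zero_le_two
    (mul_nonneg (by positivity) (by linarith))
  -- The hypothesis `herr` lets the unstable transitions use up at most half of `δ ^ 2`.
  have h1 : ENNReal.ofReal (δ ^ 2) ≤ Q + ENNReal.ofReal (δ ^ 2 / 2) := by
    rw [ENNReal.ofReal_pow hδ.le]
    calc _ ≤ ENNReal.ofReal (successProbability μ A (Set.Icc (-κ) κ)) ^ 2 := by gcongr
      _ ≤ _ := hF
      _ ≤ Q + ENNReal.ofReal (η ^ 2 * N)⁻¹ * (ENNReal.ofReal (l * N) + ENNReal.ofReal l⁻¹ *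
          (ENNReal.ofReal (2 * ((D + 1) * (1 - a))) * ENNReal.ofReal (C * N))) := by gcongr
      _ ≤ _ := by
          rw [← ENNReal.ofReal_mul h1a, ← ENNReal.ofReal_mul (by positivity),
            ← ENNReal.ofReal_add (by positivity) (by positivity),
            ← ENNReal.ofReal_mul (by positivity)]
          gcongr
          rw [inv_mul_le_iff₀ hθ]
          calc _ = (l + l⁻¹ * (2 * ((D + 1) * (1 - a)) * C)) * N := by ring
            _ ≤ (δ ^ 2 / 2 * η ^ 2) * N := by gcongr
            _ = _ := by ring
  have h2 : ENNReal.ofReal (δ ^ 2 / 2) ≤ Q := by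
    have h3 : ENNReal.ofReal (δ ^ 2) = ENNReal.ofReal (δ ^ 2 / 2) + ENNReal.ofReal (δ ^ 2 / 2) := by
      rw [← ENNReal.ofReal_add (by positivity) (by positivity)]
      congr 1
      ring
    rw [h3] at h1
    exact (ENNReal.add_le_add_iff_right ENNReal.ofReal_ne_top).1 h1
  have hR := measurableSet_stablePairs hFm (measurableSet_Icc : MeasurableSet (Set.Icc (-κ) κ))
    (η ^ 2 * N)
  have h3 := pow_le_lintegral_transfer_iterate h hR stablePairs_symm r
  have h4 := measure_pathSet_stablePairs_le hN h hFc hL0 (pow_pos two_pos r) hnr hs hs1 hη.le hst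
    hκ hL
  have h5 : (Measure.pi fun _ : Fin (2 ^ r + 1) => disorderLaw M N)
      (pathSet a b (stablePairs F (Set.Icc (-κ) κ) (η ^ 2 * N)) (2 ^ r)) =
      ∫⁻ x, (transfer a b (stablePairs F (Set.Icc (-κ) κ) (η ^ 2 * N)))^[2 ^ r] 1 x
        ∂(disorderLaw M N) := measure_pathSet hR _
  have h6 : ENNReal.ofReal (δ ^ 2 / 2) ^ 2 ^ r ≤ (nearTuples N n t).card *
      (((2 ^ r + 1) ^ (n + 1) : ℕ) *
        ENNReal.ofReal (2 * κ / (√(2 * Real.pi) * s)) ^ ((n + 1) * M)) := by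
    calc _ ≤ Q ^ 2 ^ r := by gcongr
      _ ≤ _ := h3
      _ ≤ _ := h5 ▸ h4
  rw [← ENNReal.ofReal_pow (by positivity), ← ENNReal.ofReal_pow (by positivity),
    ← ENNReal.ofReal_natCast, ← ENNReal.ofReal_natCast, ← ENNReal.ofReal_mul (by positivity),
    ← ENNReal.ofReal_mul (by positivity), ENNReal.ofReal_le_ofReal_iff (by positivity)] at h6
  push_cast at h6
  exact h6

lemma ballRate_two_mul_sq_le {κ : ℝ} (hκ : 0 < κ) :
    ballRate (2 * κ ^ 2) ≤ 4 * κ ^ 2 * Real.log (1 / κ) + 2 * κ ^ 2 := by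
  rw [ballRate]
  have h1 : Real.log (1 / (2 * κ ^ 2)) = 2 * Real.log (1 / κ) - Real.log 2 := by
    rw [one_div, one_div, Real.log_inv, Real.log_inv, Real.log_mul two_ne_zero (by positivity),
      Real.log_pow]
    push_cast
    ring
  rw [h1]
  have h2 := Real.log_pos one_lt_two
  have h3 : 0 ≤ 2 * κ ^ 2 * Real.log 2 := by positivity
  linarith

lemma exists_pow_two_between {m : ℕ} (hm : 0 < m) : ∃ r : ℕ, m ≤ 2 ^ r ∧ 2 ^ r ≤ 2 * m := by
  refine ⟨Nat.log 2 m + 1, (Nat.lt_pow_succ_log_self one_lt_two m).le, ?_⟩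
  have := Nat.pow_log_le_self 2 hm.ne'
  rw [pow_succ]
  omega

lemma one_sub_pow_two_mul_le_half {ε : ℝ} (hε1 : ε ≤ 1) {L : ℕ} (hL : 1 ≤ L * ε) :
    (1 - ε) ^ (2 * L) ≤ 1 / 2 := by
  have h0 : 0 ≤ 1 - ε := by linarith
  calc (1 - ε) ^ (2 * L) ≤ Real.exp (-ε) ^ (2 * L) :=
        pow_le_pow_left₀ h0 (Real.one_sub_le_exp_neg ε) _
    _ = Real.exp (-(2 * (L * ε))) := by
        rw [← Real.exp_nat_mul]
        congr 1
        push_cast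
        ring
    _ ≤ Real.exp (-1) := Real.exp_le_exp.2 (by linarith)
    _ ≤ 1 / 2 := by
        rw [Real.exp_neg, inv_eq_one_div]
        refine one_div_le_one_div_of_le two_pos ?_
        have := Real.add_one_le_exp (1 : ℝ)
        linarith

lemma six_le_log_one_div {κ : ℝ} (hκ : 0 < κ) (hκ₀ : κ < Real.exp (-6)) :
    6 ≤ Real.log (1 / κ) := by
  rw [one_div, Real.log_inv]
  have := Real.log_lt_log hκ hκ₀
  rw [Real.log_exp] at this
  linarith

lemma exp_neg_six_le : Real.exp (-6) ≤ 1 / 4 := by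
  have h2 : (4 : ℝ) ≤ Real.exp 6 := by
    have := Real.add_one_le_exp (6 : ℝ)
    linarith
  rw [Real.exp_neg, inv_eq_one_div]
  exact one_div_le_one_div_of_le (by norm_num) h2

/-- The entropy of the near tuples loses against the probability that they are all solutions, so
the first moment is exponentially small, unless the chain is long. -/
lemma le_of_pow_le_firstMoment {κ d : ℝ} (hκ : 0 < κ) (hlog : 6 ≤ Real.log (1 / κ)) (hd : 0 < d)
    {n q r M N : ℕ} (hn : 2 ≤ n * κ ^ 2) (hM : 9 * κ ^ 2 * Real.log (1 / κ) * N ≤ M)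
    (h : d ^ 2 ^ r ≤ (2 ^ N * ((2 * q + 1) ^ n * Real.exp (N * ballRate (2 * κ ^ 2))) ^ n) *
      ((2 ^ r + 1) ^ (n + 1) * Real.exp (-(1 / 2)) ^ ((n + 1) * M))) :
    (N : ℝ) ≤ n * (n * Real.log (2 * q + 1)) + (n + 1 + -Real.log d) * 2 ^ r := by
  have hq : (0 : ℝ) < 2 * q + 1 := by positivity
  have h1 := Real.log_le_log (pow_pos hd _) h
  obtain ⟨K, hK⟩ : ∃ K : ℝ, K = 2 ^ r := ⟨_, rfl⟩
  have hK0 : 0 < K := by rw [hK]; positivity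
  rw [Real.log_pow, Nat.cast_pow, Nat.cast_two, ← hK] at h1
  rw [← hK]
  obtain ⟨ρ, hρ⟩ : ∃ ρ, ρ = ballRate (2 * κ ^ 2) := ⟨_, rfl⟩
  have hrate := ballRate_two_mul_sq_le hκ
  rw [← hρ] at h1 hrate
  rw [Real.log_mul (by positivity) (by positivity), Real.log_mul (by positivity) (by positivity),
    Real.log_mul (by positivity) (by positivity), Real.log_pow, Real.log_pow, Real.log_pow,
    Real.log_pow, Real.log_exp, Real.log_mul (by positivity) (by positivity),
    Real.log_pow, Real.log_exp] at h1
  push_cast at h1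
  -- Budget in the exponent. Each of `n` points costs at least `(9/2) κ² log (1/κ) N` and has
  -- entropy at most `(4 κ² log (1/κ) + 2 κ²) N`. The surplus `κ² (log (1/κ) / 2 - 2) N` is at least
  -- `κ² N` as `log (1/κ) ≥ 6`. As `n κ² ≥ 2`, the total surplus is at least `2N`, of which the
  -- first point uses at most `N`.
  have h2 : (N : ℝ) * Real.log 2 ≤ N := by
    have := Real.log_le_sub_one_of_pos (two_pos : (0 : ℝ) < 2)
    exact mul_le_of_le_one_right (by positivity) (by linarith)
  have h3 : (n + 1 : ℝ) * Real.log (K + 1) ≤ (n + 1) * K := by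
    have := Real.log_le_sub_one_of_pos (by positivity : (0 : ℝ) < K + 1)
    gcongr
    linarith
  have h4 : (n : ℝ) * (N * ρ) ≤ n * (N * (4 * κ ^ 2 * Real.log (1 / κ) + 2 * κ ^ 2)) := by gcongr
  have h5 : (n : ℝ) * (9 * κ ^ 2 * Real.log (1 / κ) * N) ≤ (n + 1) * M := by
    have h3 : (n : ℝ) * (9 * κ ^ 2 * Real.log (1 / κ) * N) ≤ n * M := by gcongr
    have h4 : (0 : ℝ) ≤ M := by positivity
    linarith
  have h6 : (n : ℝ) * κ ^ 2 * N * 1 ≤ n * κ ^ 2 * N * (Real.log (1 / κ) / 2 - 2) := by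
    gcongr
    linarith
  have h7 : 2 * (N : ℝ) ≤ n * κ ^ 2 * N := by gcongr
  linarith

/-- The discretization parameters: the number of reference points and the mesh. -/
lemma exists_mesh {κ : ℝ} (hκ : 0 < κ) (hκ1 : κ < 1) : ∃ n q : ℕ, 0 < n ∧ 0 < q ∧
    2 ≤ n * κ ^ 2 ∧ (n : ℝ) / q ^ 2 ≤ κ ^ 2 / 10 := by
  obtain ⟨n, hn⟩ := exists_nat_ge (2 / κ ^ 2)
  have hn' : 2 ≤ n * κ ^ 2 := by rwa [div_le_iff₀ (by positivity)] at hn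
  have hn0 : 0 < n := by
    rcases Nat.eq_zero_or_pos n with h | h
    · rw [h] at hn'; norm_num at hn'
    · exact h
  obtain ⟨q, hq⟩ := exists_nat_ge (10 * n / κ ^ 2)
  have hq1 : (1 : ℝ) ≤ q := by
    refine le_trans ?_ hq
    rw [le_div_iff₀ (by positivity)]
    have : (1 : ℝ) ≤ n := by exact_mod_cast hn0
    nlinarith
  have hq0 : 0 < q := by exact_mod_cast hq1
  refine ⟨n, q, hn0, hq0, hn', ?_⟩
  rw [div_le_iff₀ (by positivity)] at hq
  rw [div_le_iff₀ (by positivity)]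
  nlinarith [mul_le_mul_of_nonneg_left hq1 (by positivity : 0 ≤ (q : ℝ) * κ ^ 2)]

/-- The first moment bound applied to an algorithm of correlation `1 - ε` with `ε = c / (D + 1)`. -/
lemma natCast_le_of_le_successProbability {κ : ℝ} (hκ : 0 < κ) (hκ₀ : κ < Real.exp (-6))
    {C δ l c : ℝ} (hC : 0 < C) (hδ : 0 < δ) (hl : l = (κ / 24) ^ 2 * δ ^ 2 / 4) (hc : 0 < c)
    (hc1 : c ≤ 1 / 2) (hc2 : 2 * c * C ≤ l ^ 2) {n q : ℕ} (hq0 : 0 < q)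
    (hn : 2 ≤ n * κ ^ 2) (hq : (n : ℝ) / q ^ 2 ≤ κ ^ 2 / 10) {N M D L r : ℕ} (hN : 0 < N)
    (hM : 9 * κ ^ 2 * Real.log (1 / κ) * N ≤ M)
    {Ω : Type*} [MeasurableSpace Ω] (μ : Measure Ω) [IsProbabilityMeasure μ]
    {A : Disorder M N → Ω → EuclideanSpace ℝ (Fin N)} (hAm : Measurable (Function.uncurry A))
    (hA : IsPolynomialOfDegree D A) (hAC : secondMoment μ A ≤ ENNReal.ofReal (C * N))
    (hsucc : δ ≤ successProbability μ A (Set.Icc (-κ) κ)) (hL : (D + 1) / c ≤ L)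
    (hr : n * L ≤ 2 ^ r) :
    (N : ℝ) ≤ n * (n * Real.log (2 * q + 1)) + (n + 1 + -Real.log (δ ^ 2 / 2)) * 2 ^ r := by
  have hD : (1 : ℝ) ≤ D + 1 := le_add_of_nonneg_left (Nat.cast_nonneg D)
  have hD0 : (0 : ℝ) < D + 1 := by linarith
  have hκ4 : κ < 1 / 4 := hκ₀.trans_le exp_neg_six_le
  have hl0 : 0 < l := by rw [hl]; positivity
  have hL0 : 0 < L := by
    have : (0 : ℝ) < L := lt_of_lt_of_le (by positivity) hL
    exact_mod_cast this
  -- This makes the instability `(D + 1) ε = c` independent of the degree, while about `1 / ε = (D +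
  -- 1) / c` steps decorrelate the disorder.
  obtain ⟨ε, hε⟩ : ∃ ε : ℝ, ε = c / (D + 1) := ⟨_, rfl⟩
  have hDε : (D + 1) * ε = c := by rw [hε]; field_simp
  have hε0 : 0 < ε := by rw [hε]; positivity
  have hε1 : ε ≤ 1 / 2 := by
    rw [hε, div_le_iff₀ hD0]
    linarith
  have hLε : 1 ≤ L * ε := by
    rw [hε, ← div_le_iff₀ (by positivity), one_div_div]
    exact hL
  have ha0 : 0 ≤ 1 - ε := by linarith
  have hab0 : 0 < 1 - (1 - ε) ^ 2 := by nlinarith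
  have hab : (1 - ε) ^ 2 + √(1 - (1 - ε) ^ 2) ^ 2 = 1 := by
    rw [Real.sq_sqrt hab0.le]
    ring
  have hmix : (4 / 3 * κ) ^ 2 ≤ 1 - (1 - ε) ^ (2 * L) := by
    have := one_sub_pow_two_mul_le_half (by linarith) hLε
    nlinarith
  -- With `η = κ / 24`, `l` is half of the allowed error `δ ^ 2 / 2 * η ^ 2`, and `c` is small
  -- enough that the second term is also at most `l`.
  have herr : l + l⁻¹ * (2 * ((D + 1) * (1 - (1 - ε))) * C) ≤ δ ^ 2 / 2 * (κ / 24) ^ 2 := by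
    rw [sub_sub_cancel, hDε]
    have h2 : l⁻¹ * (2 * c * C) ≤ l := by
      rw [inv_mul_le_iff₀ hl0]
      linarith
    have h3 : l + l = δ ^ 2 / 2 * (κ / 24) ^ 2 := by rw [hl]; ring
    linarith
  have key := pow_le_of_le_successProbability hN μ hAm hA hC.le hAC hδ hsucc ha0
    (Real.sqrt_pos.2 hab0) hab hl0 hκ.le (by positivity : 0 < 4 / 3 * κ) (by linarith)
    (by positivity : 0 < κ / 24) (by linarith : 4 / 3 * κ + κ / 24 ≤ 33 / 24 * κ) herr hL0 hr hmix
  -- Here `t = s + η = (32 + 1) κ / 24`, and `(33/24)² + 1/10 < 2` leaves room for the mesh error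
  -- inside `x = 2 κ ^ 2`.
  have hcard := card_nearTuples_le (N := N) (n := n) (m := n) hq0 (t := 33 / 24 * κ)
    (x := 2 * κ ^ 2) (by positivity) (by nlinarith) (by nlinarith) le_rfl
  have hratio := small_ball_ratio_le hκ
  refine le_of_pow_le_firstMoment hκ (six_le_log_one_div hκ hκ₀) (by positivity) hn hM
    (key.trans ?_)
  gcongr

/-- Quantitative strong low degree hardness of the symmetric binary perceptron. -/
theorem successProbability_lt_of_degree_small {κ : ℝ} (hκ : 0 < κ) (hκ₀ : κ < Real.exp (-6))
    {C : ℝ} (hC : 0 < C) {δ : ℝ} (hδ : 0 < δ) (hδ1 : δ ≤ 1) :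
    ∃ B : ℝ, ∀ N M D : ℕ, B * (D + 1) ≤ N → 9 * κ ^ 2 * Real.log (1 / κ) * N ≤ M →
      ∀ (Ω : Type*) [MeasurableSpace Ω] (μ : Measure Ω) [IsProbabilityMeasure μ]
        (A : Disorder M N → Ω → EuclideanSpace ℝ (Fin N)), Measurable (Function.uncurry A) →
        IsPolynomialOfDegree D A → secondMoment μ A ≤ ENNReal.ofReal (C * N) →
        successProbability μ A (Set.Icc (-κ) κ) < δ := by
  obtain ⟨n, q, hn0, hq0, hn, hq⟩ := exists_mesh hκ (by linarith [exp_neg_six_le])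
  obtain ⟨l, hl⟩ : ∃ l : ℝ, l = (κ / 24) ^ 2 * δ ^ 2 / 4 := ⟨_, rfl⟩
  have hl0 : 0 < l := by rw [hl]; positivity
  obtain ⟨c, hc0, hc1, hc2⟩ : ∃ c : ℝ, 0 < c ∧ c ≤ 1 / 2 ∧ 2 * c * C ≤ l ^ 2 := by
    refine ⟨min (1 / 2) (l ^ 2 / (2 * C)), by positivity, min_le_left _ _, ?_⟩
    have := min_le_right (1 / 2) (l ^ 2 / (2 * C))
    rw [le_div_iff₀ (by positivity)] at this
    linarith
  obtain ⟨c₁, hc₁⟩ : ∃ c₁, c₁ = n * (n * Real.log (2 * q + 1)) := ⟨_, rfl⟩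
  have hc₁0 : 0 ≤ c₁ := by
    have : 0 ≤ Real.log (2 * q + 1) := Real.log_nonneg (by linarith [Nat.cast_nonneg (α := ℝ) q])
    rw [hc₁]
    positivity
  obtain ⟨c₂, hc₂⟩ : ∃ c₂, c₂ = (n + 1 : ℝ) + -Real.log (δ ^ 2 / 2) := ⟨_, rfl⟩
  have hc₂0 : 0 ≤ c₂ := by
    have : Real.log (δ ^ 2 / 2) ≤ 0 := Real.log_nonpos (by positivity) (by nlinarith)
    have : (0 : ℝ) ≤ n := Nat.cast_nonneg n
    linarith
  obtain ⟨c₃, hc₃⟩ : ∃ c₃, c₃ = 2 * n * (1 / c + 1) := ⟨_, rfl⟩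
  have hc₃0 : 0 ≤ c₃ := by rw [hc₃]; positivity
  -- Success would force `N ≤ c₁ + c₂ * 2 ^ r`, with chain length `2 ^ r ≤ c₃ * (D + 1)`; the extra
  -- `1` makes this contradict `hND`.
  refine ⟨c₁ + c₂ * c₃ + 1, fun N M D hND hM Ω _ μ _ A hAm hA hAC => ?_⟩
  by_contra! hsucc
  have hD1 : (1 : ℝ) ≤ D + 1 := le_add_of_nonneg_left (Nat.cast_nonneg D)
  have h23 : 0 ≤ c₂ * c₃ := mul_nonneg hc₂0 hc₃0
  have hN0 : 0 < N := by
    have : (1 : ℝ) ≤ N := le_trans (by nlinarith) hND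
    exact_mod_cast this
  obtain ⟨L, hL⟩ : ∃ L, L = ⌈(D + 1) / c⌉₊ := ⟨_, rfl⟩
  have hLge : (D + 1) / c ≤ L := hL ▸ Nat.le_ceil _
  have hL0 : 0 < L := hL ▸ Nat.ceil_pos.2 (by positivity)
  have hLle : (L : ℝ) ≤ (D + 1) / c + 1 := hL ▸ (Nat.ceil_lt_add_one (by positivity)).le
  obtain ⟨r, hnr, hr2⟩ := exists_pow_two_between (Nat.mul_pos hn0 hL0)
  have hK : (2 : ℝ) ^ r ≤ c₃ * (D + 1) := by
    calc (2 : ℝ) ^ r ≤ 2 * (n * L) := by exact_mod_cast hr2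
      _ ≤ 2 * (n * ((D + 1) / c + (D + 1))) := by gcongr; linarith
      _ = _ := by rw [hc₃]; ring
  have h1 := natCast_le_of_le_successProbability hκ hκ₀ hC hδ hl hc0 hc1 hc2 hq0 hn hq hN0 hM μ
    hAm hA hAC hsucc hLge hnr
  rw [← hc₁, ← hc₂] at h1
  have h2 : c₂ * 2 ^ r ≤ c₂ * (c₃ * (D + 1)) := mul_le_mul_of_nonneg_left hK hc₂0
  have h3 : c₁ ≤ c₁ * (D + 1) := le_mul_of_one_le_right hc₁0 hD1
  linarith

end Hardness

end IsingPerceptron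

/-! ### Passage to the limit. -/

lemma isLittleO_natCast_of_isLittleO_div_log {D : ℕ → ℕ}
    (hD : (fun N : ℕ => (D N : ℝ)) =o[atTop] (fun N : ℕ => (N : ℝ) / Real.log N)) (B : ℝ) :
    ∀ᶠ N : ℕ in atTop, B * (D N + 1) ≤ N := by
  set B' := |B| + 1 with hB'
  have hB0 : 0 < B' := by positivity
  have h1 := hD.bound (c := 1 / (2 * B')) (by positivity)
  have h2 : ∀ᶠ N : ℕ in atTop, (1 : ℝ) ≤ Real.log N :=
    (Real.tendsto_log_atTop.comp tendsto_natCast_atTop_atTop).eventually_ge_atTop 1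
  have h3 : ∀ᶠ N : ℕ in atTop, 2 * B' ≤ (N : ℝ) :=
    tendsto_natCast_atTop_atTop.eventually_ge_atTop _
  filter_upwards [h1, h2, h3] with N h1 h2 h3
  have hN : (0 : ℝ) ≤ N := by positivity
  rw [Real.norm_of_nonneg (by positivity), Real.norm_of_nonneg (by positivity)] at h1
  have h4 : (N : ℝ) / Real.log N ≤ N := div_le_self hN h2
  have h5 : (D N : ℝ) ≤ 1 / (2 * B') * N := h1.trans (by gcongr)
  have h6 : B' * D N ≤ N / 2 := by
    calc B' * D N ≤ B' * (1 / (2 * B') * N) := by gcongr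
      _ = N / 2 := by field_simp
  have h7 : B ≤ B' := by rw [hB']; linarith [le_abs_self B]
  calc B * (D N + 1) ≤ B' * (D N + 1) := by gcongr
    _ = B' * D N + B' := by ring
    _ ≤ N := by linarith

theorem corollary3p5 :
    ∃ κ₀ : ℝ, 0 < κ₀ ∧ ∀ κ : ℝ, 0 < κ → κ < κ₀ →
      ∀ α : ℝ, 10 * κ ^ 2 * Real.log (1 / κ) ≤ α →
      ∀ M : ℕ → ℕ, Tendsto (fun N : ℕ => (M N : ℝ) / (N : ℝ)) atTop (𝓝 α) →
      ∀ D : ℕ → ℕ, (fun N : ℕ => (D N : ℝ)) =o[atTop] (fun N : ℕ => (N : ℝ) / Real.log N) →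
      ∀ C : ℝ, 0 < C →
      ∃ p : ℕ → ℝ, Tendsto p atTop (𝓝 0) ∧
        ∀ (N : ℕ) (Ω : Type*) [TopologicalSpace Ω] [PolishSpace Ω] [MeasurableSpace Ω]
          [BorelSpace Ω] (μ : Measure Ω) [IsProbabilityMeasure μ]
          (A : IsingPerceptron.Disorder (M N) N → Ω → EuclideanSpace ℝ (Fin N)),
          Measurable (Function.uncurry A) →
          IsingPerceptron.IsPolynomialOfDegree (D N) A →
          IsingPerceptron.secondMoment μ A ≤ ENNReal.ofReal (C * N) →
          IsingPerceptron.successProbability μ A (Set.Icc (-κ) κ) ≤ p N := by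
  refine ⟨Real.exp (-6), Real.exp_pos _, fun κ hκ hκ₀ α hα M hM D hD C hC => ?_⟩
  -- Taking `p N` as the supremum over all admissible algorithms makes the bound uniform in the
  -- algorithm and its auxiliary space.
  let S : ℕ → Set ℝ := fun N => {x | ∃ (Ω : Type _) (_ : MeasurableSpace Ω) (μ : Measure Ω)
    (_ : IsProbabilityMeasure μ)
    (A : IsingPerceptron.Disorder (M N) N → Ω → EuclideanSpace ℝ (Fin N)),
    Measurable (Function.uncurry A) ∧ IsingPerceptron.IsPolynomialOfDegree (D N) A ∧
    IsingPerceptron.secondMoment μ A ≤ ENNReal.ofReal (C * N) ∧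
    x = IsingPerceptron.successProbability μ A (Set.Icc (-κ) κ)}
  have hbdd : ∀ N, BddAbove (S N) := by
    refine fun N => ⟨1, ?_⟩
    rintro _ ⟨Ω, _, μ, _, A, -, -, -, rfl⟩
    exact measureReal_le_one
  refine ⟨fun N => sSup (S N), ?_, fun N Ω _ _ _ _ μ _ A hAm hA hAC =>
    le_csSup (hbdd N) ⟨Ω, inferInstance, μ, inferInstance, A, hAm, hA, hAC, rfl⟩⟩
  have hpos : ∀ N, 0 ≤ sSup (S N) := by
    refine fun N => Real.sSup_nonneg ?_
    rintro _ ⟨Ω, _, μ, _, A, -, -, -, rfl⟩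
    exact measureReal_nonneg
  have hlog : 6 < Real.log (1 / κ) := by
    rw [one_div, Real.log_inv]
    have := Real.log_lt_log hκ hκ₀
    rw [Real.log_exp] at this
    linarith
  -- The gap between `10` and `9` absorbs the fluctuation of `M N / N` around its limit.
  have hMN : ∀ᶠ N : ℕ in atTop, 9 * κ ^ 2 * Real.log (1 / κ) * N ≤ M N := by
    have h1 : 9 * κ ^ 2 * Real.log (1 / κ) < α := by
      have : 0 < κ ^ 2 * Real.log (1 / κ) := by positivity
      linarith
    filter_upwards [hM.eventually (eventually_gt_nhds h1), eventually_gt_atTop 0] with N hN hN0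
    have : (0 : ℝ) < N := by exact_mod_cast hN0
    rw [lt_div_iff₀ this] at hN
    exact hN.le
  rw [Metric.tendsto_atTop']
  intro e he
  set δ := min (e / 2) 1 with hδ
  have hδ0 : 0 < δ := by positivity
  obtain ⟨B, hB⟩ := IsingPerceptron.successProbability_lt_of_degree_small hκ hκ₀ hC hδ0
    (min_le_right _ _)
  obtain ⟨N₀, hN₀⟩ := eventually_atTop.1
    (hMN.and (isLittleO_natCast_of_isLittleO_div_log hD B))
  refine ⟨N₀, fun N hN => ?_⟩
  obtain ⟨h1, h2⟩ := hN₀ N hN.le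
  rw [Real.dist_eq, sub_zero, abs_of_nonneg (hpos N)]
  have h3 : sSup (S N) ≤ δ := by
    refine Real.sSup_le ?_ hδ0.le
    rintro _ ⟨Ω, _, μ, _, A, hAm, hA, hAC, rfl⟩
    exact (hB N (M N) (D N) h2 h1 Ω μ A hAm hA hAC).le
  have h4 : δ ≤ e / 2 := min_le_left _ _
  linarith
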